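/- **Verifiers.** A PostPFA verifier (postselecting realtime probabilistic finite automaton verifier) with finite input alphabet $\Sigma$ and end-markers $\vdash,\dashv$ (not in $\Sigma$) has a finite nonempty certificate alphabet $\Upsilon$, a finite set of states $S$, a start state $s_I$, two different postselecting states $s_{pa}$ (accepting) and $s_{pr}$ (rejecting), and a transition function $\delta : S\times(\Sigma\cup\{\vdash,\dashv\})\times\Upsilon\times S\times\{0,1\}\to[0,1]$ with real values such that $\sum_{s',d}\delta(s,\sigma,\upsilon,s',d)=1$ for all $s,\sigma,\upsilon$. Given an input $w\in\Sigma^*$ and an infinite certificate $c\in\Upsilon^\infty$, it starts in $s_I$ on the first symbol of $c$ and reads $\vdash w\dashv$ from left to right, one symbol per step. In state $s$, reading the input symbol $\sigma$ and the current certificate symbol $\upsilon$, it goes to state $s'$ and moves to the next certificate symbol (if $d=1$) or stays on the current one (if $d=0$) with probability $\delta(s,\sigma,\upsilon,s',d)$. Let $a$ and $r$ be the probabilities of being in $s_{pa}$ and in $s_{pr}$ after $\dashv$ has been read; it is required that $a+r>0$ for every $w$ and $c$. The verifier accepts $w$ with certificate $c$ with probability $a/(a+r)$ and rejects it with probability $r/(a+r)$.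 It verifies a language $L\subseteq\Sigma^*$ with error bound $\epsilon$ if every $w\in L$ has a certificate with which $w$ is accepted with probability at least $1-\epsilon$, and every $w\in\Sigma^*\setminus L$ is rejected with probability at least $1-\epsilon$ with every certificate $c\in\Upsilon^\infty$. It verifies $L$ with bounded error if it does so with some error bound $\epsilon<\frac12$. **Magic coins.** For a set $I$ of positive integers let $p_I=0.x_1\,0\,1\,x_2\,0\,1\,x_3\,0\,1\cdots$ (in binary), where $x_i=1$ if $i\in I$ and $x_i=0$ otherwise, and let $\mathfrak{coin}_I$ be the coin that lands on head with probability $p_I$. A verifier uses only rational probabilities and $\mathfrak{coin}_I$ if $\delta=p_I\,\delta_{h}+(1-p_I)\,\delta_{t}$ for two rational-valued transition functions $\delta_{h},\delta_{t}$, each satisfying the conditions on $\delta$ above. **Theorem.** For every set $I$ of positive integers, the unary language $$\mathtt{UPOWER6}(I)=\{0^{2^{6k}} : k\in I\}\subseteq\{0\}^*$$ is verified with error bound $\frac25$ by a PostPFA verifier that uses only rational probabilities and $\mathfrak{coin}_I$. Moreover, the set of unary languages $L\subseteq\{0\}^*$ that are verified with bounded error by PostPFA verifiers is uncountable. -/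

import Mathlib

/-- Symbols of the tape: the input symbols and the two end-markers. -/
inductive TapeSymbol (A : Type) : Type where
  | leftEnd : TapeSymbol A
  | input (a : A) : TapeSymbol A
  | rightEnd : TapeSymbol A

/-- The tape content for the input word `w`: the word between the two end-markers. -/
def tape {A : Type} (w : List A) : List (TapeSymbol A) :=
  TapeSymbol.leftEnd :: (w.map TapeSymbol.input ++ [TapeSymbol.rightEnd])

/-- The transition probabilities `δ s σ υ s' d` (in state `s`, reading tape symbol `σ` and
certificate symbol `υ`, go to state `s'` and perform action `d` on the certificate) are
well-formed. The action `true` moves to the next certificate symbol, `false` stays. -/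
def IsTransitionFunction {A Y S : Type} [Fintype S]
    (δ : S → TapeSymbol A → Y → S → Bool → ℝ) : Prop :=
  (∀ s σ υ s' d, δ s σ υ s' d ∈ Set.Icc (0 : ℝ) 1) ∧
    ∀ s σ υ, ∑ s', ∑ d, δ s σ υ s' d = 1

/-- The probability that a realtime machine with transition function `δ`, being in state `s`
with its certificate head on position `j` of the infinite certificate `c` and having the list
of tape symbols left to read, is in state `t` after reading all of them. Exactly one tape
symbol is read in each step. -/
def endProb {A Y S : Type} [Fintype S] [DecidableEq S]
    (δ : S → TapeSymbol A → Y → S → Bool → ℝ) (c : ℕ → Y) (t : S) :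
    List (TapeSymbol A) → S → ℕ → ℝ
  | [], s, _ => if s = t then 1 else 0
  | σ :: τ, s, j =>
      ∑ s', ∑ d, δ s σ (c j) s' d * endProb δ c t τ s' (if d = true then j + 1 else j)

/-- A postselecting realtime probabilistic finite automaton verifier with input alphabet `A`,
certificate alphabet `Y` and finite set of states `S`, with real-valued transitions. -/
structure PostPFAVerifier (A Y S : Type) [Fintype S] [DecidableEq S] where
  δ : S → TapeSymbol A → Y → S → Bool → ℝ
  start : S
  postAcc : S
  postRej : S
  postAcc_ne_postRej : postAcc ≠ postRej
  isTransitionFunction : IsTransitionFunction δ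
  /-- Postselection is possible on every input and with every certificate. -/
  postselection : ∀ (w : List A) (c : ℕ → Y),
    0 < endProb δ c postAcc (tape w) start 0 + endProb δ c postRej (tape w) start 0

namespace PostPFAVerifier

variable {A Y S : Type} [Fintype S] [DecidableEq S]

/-- The probability `a(w)` of ending in the postselecting accepting state. -/
def a (V : PostPFAVerifier A Y S) (w : List A) (c : ℕ → Y) : ℝ :=
  endProb V.δ c V.postAcc (tape w) V.start 0

/-- The probability `r(w)` of ending in the postselecting rejecting state. -/
def r (V : PostPFAVerifier A Y S) (w : List A) (c : ℕ → Y) : ℝ :=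
  endProb V.δ c V.postRej (tape w) V.start 0

/-- The acceptance probability of `w` with certificate `c`, after postselection. -/
noncomputable def acceptProb (V : PostPFAVerifier A Y S) (w : List A) (c : ℕ → Y) : ℝ :=
  V.a w c / (V.a w c + V.r w c)

/-- The rejection probability of `w` with certificate `c`, after postselection. -/
noncomputable def rejectProb (V : PostPFAVerifier A Y S) (w : List A) (c : ℕ → Y) : ℝ :=
  V.r w c / (V.a w c + V.r w c)

/-- `V` verifies the language `L` with error bound `ε`: completeness and soundness. -/
def Verifies (V : PostPFAVerifier A Y S) (L : Language A) (ε : ℝ) : Prop :=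
  (∀ w ∈ L, ∃ c : ℕ → Y, 1 - ε ≤ V.acceptProb w c) ∧
    ∀ w, w ∉ L → ∀ c : ℕ → Y, 1 - ε ≤ V.rejectProb w c

/-- Apart from rational-valued probabilities, `V` only uses a coin that lands on head with
probability `p`: in each step the coin is tossed (at most) once, and the move is then chosen
by the rational-valued transition function belonging to the outcome. -/
def UsesCoin (V : PostPFAVerifier A Y S) (p : ℝ) : Prop :=
  ∃ head tail : S → TapeSymbol A → Y → S → Bool → ℚ,
    IsTransitionFunction (fun s σ υ s' d => (head s σ υ s' d : ℝ)) ∧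
    IsTransitionFunction (fun s σ υ s' d => (tail s σ υ s' d : ℝ)) ∧
    ∀ s σ υ s' d,
      V.δ s σ υ s' d = p * (head s σ υ s' d : ℝ) + (1 - p) * (tail s σ υ s' d : ℝ)

end PostPFAVerifier

/-- `L` is verified with bounded error by some PostPFA verifier, with finite non-empty
certificate alphabet and finitely many states. -/
def IsVerifiedByPostPFA {A : Type} (L : Language A) : Prop :=
  ∃ (Y S : Type) (_ : Fintype Y) (_ : Nonempty Y) (_ : Fintype S) (_ : DecidableEq S)
    (V : PostPFAVerifier A Y S) (ε : ℝ), ε < 1 / 2 ∧ V.Verifies L ε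

open Classical in
/-- The binary digits `x₁ 0 1 x₂ 0 1 x₃ 0 1 ⋯` after the binary point, where `xᵢ = 1` if
`i ∈ I` and `xᵢ = 0` otherwise; digit number `n` (counted from `0`) with `n = 3 * i` is
`xᵢ₊₁`. -/
noncomputable def coinDigit (I : Set ℕ+) (n : ℕ) : Fin 2 :=
  if n % 3 = 0 then (if (n / 3).succPNat ∈ I then 1 else 0)
  else if n % 3 = 1 then 0
  else 1

/-- The probability `p_I = 0.x₁01x₂01x₃01⋯` (in binary) that the coin of `I` lands on head. -/
noncomputable def coinBias (I : Set ℕ+) : ℝ :=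
  Real.ofDigits (coinDigit I)

/-- The unary language of the words `0 ^ (2 ^ (6 * k))` with `k ∈ I`, over the alphabet `{0}`. -/
def UPOWER6 (I : Set ℕ+) : Language (Fin 1) :=
  {w | ∃ k ∈ I, w = List.replicate (2 ^ (6 * (k : ℕ))) 0}

/-! The digits of `coinBias I` encode `I`, and `64 ^ k` tosses are enough to read the digit `x_k`.
Multiplying the bias by `8 ^ k` moves `x_k 0 1` just before the binary point, so the expected number
of heads in `64 ^ k` tosses is `4 * 8 ^ k * (N + y)`, where `N` has parity `x_k` and `y` lies
between `1/4` and `1/2` (`exists_floor_coinBias`). The standard deviation is at most `8 ^ k / 2`. By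
Chebyshev, the number of heads falls into block number `N` of length `4 * 8 ^ k` with probability at
least `3/4`. A finite automaton cannot find the parity of a block, but a certificate with
alternating blocks can supply it: the head on the certificate advances once per head of the coin,
and the bit it finally stands on is the answer (`coinMean_alternating`).

It remains to check that the certificate alternates with this period and that the length is a power
of `64`. Both follow from linear relations between lengths of consecutive runs on two tracks, which
seven blind counters test (`exists_eq_pow_of_pass`, `exists_pass`). A counter of value `e` is kept
as two states with weights proportional to `B ^ e` and `B ^ (-e)`. Their sum is smallest at `e = 0`
and at least about `B` otherwise. All this weight goes to rejection, so correct certificates cost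
little and a single failed test outweighs acceptance (`exists_verifier_of_blindCounters`). Weights
above `1` are harmless, since postselection only sees the ratio of accepting to rejecting weight and
the machine is realtime (`exists_verifier_of_weights`).

Uncountability follows because `I` can be recovered from `UPOWER6 I`. -/

/-! ### From nonnegative weights to probabilities -/

/-- Completion of a nonnegative weight function with row sums at most `C` to a transition
function: all weights are divided by `C`, and the missing probability leads to the sink `none`. -/
def normalizedWeight {A Y S K : Type} [Field K] [Fintype S] (C : K)
    (ω : S → TapeSymbol A → Y → S → Bool → K) :
    Option S → TapeSymbol A → Y → Option S → Bool → K
  | some s, σ, y, some s', d => ω s σ y s' d / C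
  | some s, σ, y, none, d => if d then 0 else 1 - (∑ s', ∑ d, ω s σ y s' d) / C
  | none, _, _, some _, _ => 0
  | none, _, _, none, d => if d then 0 else 1

lemma isTransitionFunction_normalizedWeight {A Y S : Type} [Fintype S] {C : ℝ} (hC : 0 < C)
    {ω : S → TapeSymbol A → Y → S → Bool → ℝ} (h0 : ∀ s σ y s' d, 0 ≤ ω s σ y s' d)
    (hω : ∀ s σ y, ∑ s', ∑ d, ω s σ y s' d ≤ C) :
    IsTransitionFunction (normalizedWeight C ω) := by
  have hsum : ∀ s σ y, ∑ s', ∑ d, normalizedWeight C ω s σ y s' d = 1 := by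
    intro s σ y
    rw [Fintype.sum_option]
    cases s with
    | none => simp [normalizedWeight]
    | some s =>
      simp only [normalizedWeight, Fintype.sum_bool, ← Finset.sum_div]
      simp
  have hnn : ∀ s σ y s' d, 0 ≤ normalizedWeight C ω s σ y s' d := by
    intro s σ y s' d
    cases s with
    | none => cases s' <;> cases d <;> simp [normalizedWeight]
    | some s =>
      cases s' with
      | none =>
        cases d
        · simpa [normalizedWeight] using div_le_one_of_le₀ (by simpa using hω s σ y) hC.le
        · simp [normalizedWeight]
      | some s' => exact div_nonneg (h0 _ _ _ _ _) hC.le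
  refine ⟨fun s σ y s' d => ⟨hnn s σ y s' d, ?_⟩, hsum⟩
  rw [← hsum s σ y]
  refine le_trans ?_ (Finset.single_le_sum (f := fun s' => ∑ d, normalizedWeight C ω s σ y s' d)
    (fun s' _ => Finset.sum_nonneg fun d _ => hnn s σ y s' d) (Finset.mem_univ s'))
  exact Finset.single_le_sum (f := fun d => normalizedWeight C ω s σ y s' d)
    (fun d _ => hnn s σ y s' d) (Finset.mem_univ d)

lemma endProb_normalizedWeight_none {A Y S : Type} [Fintype S] [DecidableEq S] (C : ℝ)
    (ω : S → TapeSymbol A → Y → S → Bool → ℝ) (c : ℕ → Y) (t : S) (τ : List (TapeSymbol A))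
    (j : ℕ) : endProb (normalizedWeight C ω) c (some t) τ none j = 0 := by
  induction τ generalizing j with
  | nil => simp [endProb]
  | cons σ τ ih => simp [endProb, normalizedWeight, Fintype.sum_option, ih]

/-- Every path reads one tape symbol per step, so all paths collect the same power of `C`, and paths
through the sink never come back. The common factor cancels under postselection. -/
lemma endProb_normalizedWeight {A Y S : Type} [Fintype S] [DecidableEq S] (C : ℝ)
    (ω : S → TapeSymbol A → Y → S → Bool → ℝ) (c : ℕ → Y) (t : S) (τ : List (TapeSymbol A))
    (s : S) (j : ℕ) :
    endProb (normalizedWeight C ω) c (some t) τ (some s) j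
      = (C ^ τ.length)⁻¹ * endProb ω c t τ s j := by
  induction τ generalizing s j with
  | nil => simp [endProb]
  | cons σ τ ih =>
    simp only [endProb, Fintype.sum_option, endProb_normalizedWeight_none, ih, normalizedWeight,
      mul_zero, Finset.sum_const_zero, zero_add, Finset.mul_sum, List.length_cons, pow_succ,
      mul_inv]
    refine Finset.sum_congr rfl fun s' _ => Finset.sum_congr rfl fun d _ => ?_
    ring

instance {A : Type} [Finite A] : Finite (TapeSymbol A) := by
  refine Finite.of_injective (β := Option (Option A))
    (fun σ => match σ with
      | .leftEnd => none
      | .rightEnd => some none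
      | .input a => some (some a)) ?_
  rintro (_ | _ | _) (_ | _ | _) h <;> simp_all

/-- A weighted automaton with nonnegative weights in the cone spanned by `p` and `1 - p` over the
rationals gives a verifier which uses only the coin with bias `p`. -/
theorem exists_verifier_of_weights {A Y S : Type} [Finite A] [Finite Y] [Fintype S] [DecidableEq S]
    {p : ℝ} (hp : p ∈ Set.Icc (0 : ℝ) 1) {h t : S → TapeSymbol A → Y → S → Bool → ℚ}
    (hh : ∀ s σ y s' d, 0 ≤ h s σ y s' d) (ht : ∀ s σ y s' d, 0 ≤ t s σ y s' d)
    {ω : S → TapeSymbol A → Y → S → Bool → ℝ}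
    (hω : ∀ s σ y s' d, ω s σ y s' d = p * h s σ y s' d + (1 - p) * t s σ y s' d)
    {start acc rej : S} (hne : acc ≠ rej)
    (hpos : ∀ (w : List A) (c : ℕ → Y),
      0 < endProb ω c acc (tape w) start 0 + endProb ω c rej (tape w) start 0) :
    ∃ V : PostPFAVerifier A Y (Option S), V.UsesCoin p ∧ ∀ w c,
      V.acceptProb w c = endProb ω c acc (tape w) start 0 /
        (endProb ω c acc (tape w) start 0 + endProb ω c rej (tape w) start 0) ∧
      V.rejectProb w c = endProb ω c rej (tape w) start 0 /
        (endProb ω c acc (tape w) start 0 + endProb ω c rej (tape w) start 0) := by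
  obtain ⟨C, hC, hCh, hCt⟩ : ∃ C : ℚ, 0 < C ∧ (∀ s σ y, ∑ s', ∑ d, h s σ y s' d ≤ C) ∧
      ∀ s σ y, ∑ s', ∑ d, t s σ y s' d ≤ C := by
    obtain ⟨C₁, h₁⟩ := (Set.finite_range fun x : S × TapeSymbol A × Y =>
      ∑ s', ∑ d, h x.1 x.2.1 x.2.2 s' d).bddAbove
    obtain ⟨C₂, h₂⟩ := (Set.finite_range fun x : S × TapeSymbol A × Y =>
      ∑ s', ∑ d, t x.1 x.2.1 x.2.2 s' d).bddAbove
    -- The `1` only keeps `C` positive.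
    refine ⟨max 1 (max C₁ C₂), by positivity, fun s σ y => ?_, fun s σ y => ?_⟩
    · exact (h₁ ⟨(s, σ, y), rfl⟩).trans ((le_max_left _ _).trans (le_max_right _ _))
    · exact (h₂ ⟨(s, σ, y), rfl⟩).trans ((le_max_right _ _).trans (le_max_right _ _))
  have hC' : (0 : ℝ) < C := by exact_mod_cast hC
  have hcast : ∀ (g : S → TapeSymbol A → Y → S → Bool → ℚ),
      (fun s σ y s' d => ((normalizedWeight C g s σ y s' d : ℚ) : ℝ))
        = normalizedWeight (C : ℝ) (fun s σ y s' d => (g s σ y s' d : ℝ)) := by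
    intro g
    funext s σ y s' d
    cases s <;> cases s' <;> cases d <;> simp [normalizedWeight]
  have hth : IsTransitionFunction
      (fun s σ y s' d => ((normalizedWeight C h s σ y s' d : ℚ) : ℝ)) := by
    rw [hcast]
    refine isTransitionFunction_normalizedWeight hC' (fun s σ y s' d => ?_) fun s σ y => ?_
    · exact_mod_cast hh s σ y s' d
    · exact_mod_cast hCh s σ y
  have htt : IsTransitionFunction
      (fun s σ y s' d => ((normalizedWeight C t s σ y s' d : ℚ) : ℝ)) := by
    rw [hcast]
    refine isTransitionFunction_normalizedWeight hC' (fun s σ y s' d => ?_) fun s σ y => ?_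
    · exact_mod_cast ht s σ y s' d
    · exact_mod_cast hCt s σ y
  obtain ⟨hp0, hp1⟩ := hp
  have hT : IsTransitionFunction (normalizedWeight (C : ℝ) ω) := by
    refine isTransitionFunction_normalizedWeight hC' (fun s σ y s' d => ?_) fun s σ y => ?_
    · rw [hω]
      exact add_nonneg (mul_nonneg hp0 (by exact_mod_cast hh s σ y s' d))
        (mul_nonneg (sub_nonneg.2 hp1) (by exact_mod_cast ht s σ y s' d))
    · simp only [hω, Finset.sum_add_distrib, ← Finset.mul_sum]
      have h₁ : ∑ s', ∑ d, (h s σ y s' d : ℝ) ≤ C := by exact_mod_cast hCh s σ y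
      have h₂ : ∑ s', ∑ d, (t s σ y s' d : ℝ) ≤ C := by exact_mod_cast hCt s σ y
      nlinarith
  have hend : ∀ (w : List A) c q, endProb (normalizedWeight (C : ℝ) ω) c (some q) (tape w)
      (some start) 0 = ((C : ℝ) ^ (tape w).length)⁻¹ * endProb ω c q (tape w) start 0 :=
    fun w c q => endProb_normalizedWeight _ _ _ _ _ _ _
  have hκ : ∀ w : List A, 0 < ((C : ℝ) ^ (tape w).length)⁻¹ := fun w => by positivity
  refine ⟨⟨normalizedWeight (C : ℝ) ω, some start, some acc, some rej, by simpa using hne, hT,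
    fun w c => ?_⟩, ⟨normalizedWeight C h, normalizedWeight C t, hth, htt, ?_⟩, fun w c => ?_⟩
  · rw [hend, hend, ← mul_add]
    exact mul_pos (hκ w) (hpos w c)
  · intro s σ y s' d
    have e₁ := congrFun (congrFun (congrFun (congrFun (congrFun (hcast h) s) σ) y) s') d
    have e₂ := congrFun (congrFun (congrFun (congrFun (congrFun (hcast t) s) σ) y) s') d
    rw [e₁, e₂]
    -- Normalization by one common `C` commutes with the mixture of head and tail; for the move to
    -- the sink this uses `p + (1 - p) = 1`.
    cases s with
    | none => cases s' <;> cases d <;> simp [normalizedWeight]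
    | some s =>
      cases s' with
      | none =>
        cases d
        · simp only [normalizedWeight, hω, Finset.sum_add_distrib, ← Finset.mul_sum]
          simp only [Bool.false_eq_true, if_false]
          ring
        · simp [normalizedWeight]
      | some s' =>
        simp only [normalizedWeight, hω]
        ring
  · constructor <;>
    · simp only [PostPFAVerifier.acceptProb, PostPFAVerifier.rejectProb, PostPFAVerifier.a,
        PostPFAVerifier.r, hend, ← mul_add]
      rw [mul_div_mul_left _ _ (hκ w).ne']

/-! ### Blind counters and their penalties -/

/-- A blind integer counter driven by an infinite word: before a symbol is processed, the counter
may have to be zero, and its final value has to be zero after a last correction. All of this may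
depend on the previous symbol. -/
structure BlindCounter (Y : Type) where
  inc : Option Y → Y → ℤ
  test : Option Y → Y → Bool
  final : Option Y → ℤ

/-- The symbol before position `j` of the infinite word `c`. -/
def prevSymbol {Y : Type} (c : ℕ → Y) : ℕ → Option Y
  | 0 => none
  | j + 1 => some (c j)

namespace BlindCounter

variable {Y : Type}

/-- The value of the counter at position `j`. -/
def value (K : BlindCounter Y) (c : ℕ → Y) (j : ℕ) : ℤ :=
  ∑ i ∈ Finset.range j, K.inc (prevSymbol c i) (c i)

/-- All tests on the first `m` symbols and the final test succeed. -/
def Passes (K : BlindCounter Y) (c : ℕ → Y) (m : ℕ) : Prop :=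
  (∀ j < m, K.test (prevSymbol c j) (c j) = true → K.value c j = 0) ∧
    K.value c m + K.final (prevSymbol c m) = 0

lemma value_succ (K : BlindCounter Y) (c : ℕ → Y) (j : ℕ) :
    K.value c (j + 1) = K.value c j + K.inc (prevSymbol c j) (c j) :=
  Finset.sum_range_succ _ _

/-- The hyperbolic cosine of `e` in base `B`. -/
noncomputable def penalty (B : ℝ) (e : ℤ) : ℝ := (B ^ e + B ^ (-e)) / 2

@[simp] lemma penalty_zero (B : ℝ) : penalty B 0 = 1 := by simp [penalty]

lemma one_le_penalty {B : ℝ} (hB : 0 < B) (e : ℤ) : 1 ≤ penalty B e := by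
  have h : 0 < B ^ e := zpow_pos hB e
  rw [penalty, zpow_neg, le_div_iff₀ two_pos]
  have : B ^ e * (B ^ e)⁻¹ = 1 := mul_inv_cancel₀ h.ne'
  have h' : 0 < (B ^ e)⁻¹ := inv_pos.2 h
  nlinarith [sq_nonneg (B ^ e - (B ^ e)⁻¹)]

lemma le_penalty {B : ℝ} (hB : 1 ≤ B) {e : ℤ} (he : e ≠ 0) : B / 2 ≤ penalty B e := by
  have hB0 : 0 < B := by linarith
  have h1 : 0 < B ^ e := zpow_pos hB0 e
  have h2 : 0 < B ^ (-e) := zpow_pos hB0 (-e)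
  unfold penalty
  rcases lt_or_gt_of_ne he with h | h
  · have := zpow_le_zpow_right₀ hB (show (1 : ℤ) ≤ -e by lia)
    rw [zpow_one] at this
    linarith
  · have := zpow_le_zpow_right₀ hB (show (1 : ℤ) ≤ e by lia)
    rw [zpow_one] at this
    linarith

/-- The product of the penalties of the tests on the `n` symbols from position `j` on and of the
final test, if the counter has value `e` at position `j` and is set to zero by each test. -/
noncomputable def cost (K : BlindCounter Y) (B : ℝ) (c : ℕ → Y) : ℕ → ℕ → ℤ → ℝ
  | 0, j, e => penalty B (e + K.final (prevSymbol c j))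
  | n + 1, j, e =>
    if K.test (prevSymbol c j) (c j) = true then
      penalty B e * K.cost B c n (j + 1) (K.inc (prevSymbol c j) (c j))
    else K.cost B c n (j + 1) (e + K.inc (prevSymbol c j) (c j))

lemma one_le_cost (K : BlindCounter Y) {B : ℝ} (hB : 0 < B) (c : ℕ → Y) (n j : ℕ) (e : ℤ) :
    1 ≤ K.cost B c n j e := by
  induction n generalizing j e with
  | zero => exact one_le_penalty hB _
  | succ n ih =>
    rw [cost]
    split_ifs
    · exact one_le_mul_of_one_le_of_one_le (one_le_penalty hB _) (ih _ _)
    · exact ih _ _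

/-- As long as the tests succeed, setting the counter to zero changes nothing, so each penalty is
taken at zero. -/
lemma cost_eq_one_of_passes {K : BlindCounter Y} (B : ℝ) {c : ℕ → Y} {m : ℕ}
    (h : K.Passes c m) {n j : ℕ} (hj : j + n = m) : K.cost B c n j (K.value c j) = 1 := by
  induction n generalizing j with
  | zero =>
    obtain rfl : j = m := by lia
    rw [cost, h.2, penalty_zero]
  | succ n ih =>
    have := ih (j := j + 1) (by lia)
    rw [value_succ] at this
    rw [cost]
    split_ifs with ht
    · have h0 := h.1 j (by lia) ht
      rw [h0, zero_add] at this
      rw [this, h0, penalty_zero, one_mul]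
    · exact this

/-- Up to the first failing test the resets agree with the true value. That test contributes at
least `B / 2`, and all other factors are at least `1`, so later tests cannot repair the failure. -/
lemma le_cost_of_not_passes {K : BlindCounter Y} {B : ℝ} (hB : 1 ≤ B) {c : ℕ → Y} {m : ℕ}
    (h : ¬ K.Passes c m) {n j : ℕ} (hj : j + n = m)
    (hlt : ∀ i < j, K.test (prevSymbol c i) (c i) = true → K.value c i = 0) :
    B / 2 ≤ K.cost B c n j (K.value c j) := by
  induction n generalizing j with
  | zero =>
    obtain rfl : j = m := by lia
    exact le_penalty hB fun h0 => h ⟨hlt, h0⟩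
  | succ n ih =>
    rw [cost]
    by_cases ht : K.test (prevSymbol c j) (c j) = true
    · rw [if_pos ht]
      by_cases h0 : K.value c j = 0
      · have := ih (j := j + 1) (by lia) (by grind)
        rwa [h0, penalty_zero, one_mul, ← zero_add (K.inc _ _), ← h0, ← value_succ]
      · nlinarith [le_penalty hB h0, K.one_le_cost (by linarith : 0 < B) c n (j + 1)
          (K.inc (prevSymbol c j) (c j))]
    · rw [if_neg ht, ← value_succ]
      exact ih (by lia) (by grind)

end BlindCounter

/-! ### The weighted automaton: coin branch and counter branches -/

/-- The mean of `F` at position `j` plus the number of heads in `n` tosses of a coin. -/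
def coinMean (p : ℝ) (F : ℕ → ℝ) : ℕ → ℕ → ℝ
  | 0, j => F j
  | n + 1, j => p * coinMean p F n (j + 1) + (1 - p) * coinMean p F n j

/-- The states of the weighted automaton that either counts heads or runs a blind counter, which
is represented by a pair of states with reciprocal weights. -/
inductive CheckState (ι Y : Type) : Type where
  | start | coin | acc | rej
  | counter (i : ι) (prev : Option Y) (sign : Bool)
  deriving DecidableEq, Fintype

/-- The base of the exponential weights. -/
def penaltyBase : ℚ := 120

/-- The initial weight of each of the two states of a blind counter. -/
def counterWeight : ℚ := 1 / 80

/-- The moves of the weighted automaton: next state, action on the certificate, and weight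
after head and after tail. -/
def moves {A Y : Type} {k : ℕ} (K : Fin k → BlindCounter Y) (bit : Y → Bool) :
    CheckState (Fin k) Y → TapeSymbol A → Y → List (CheckState (Fin k) Y × Bool × ℚ × ℚ)
  | .start, .leftEnd, _ =>
    (.coin, false, 1, 1) ::
      (List.ofFn (fun i => (.counter i none true, false, counterWeight, counterWeight)) ++
        List.ofFn fun i => (.counter i none false, false, counterWeight, counterWeight))
  | .coin, .input _, _ => [(.coin, true, 1, 0), (.coin, false, 0, 1)]
  | .coin, .rightEnd, y => [(if bit y then .acc else .rej, false, 1, 1)]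
  | .counter i x s, .input _, y =>
    let z := (K i).inc x y
    if (K i).test x y then
      [(.counter i (some y) true, true, penaltyBase ^ z / 2, penaltyBase ^ z / 2),
        (.counter i (some y) false, true, penaltyBase ^ (-z) / 2, penaltyBase ^ (-z) / 2)]
    else
      [(.counter i (some y) s, true, penaltyBase ^ (if s then z else -z),
        penaltyBase ^ (if s then z else -z))]
  | .counter i x s, .rightEnd, _ =>
    let z := (K i).final x
    [(.rej, false, penaltyBase ^ (if s then z else -z), penaltyBase ^ (if s then z else -z))]
  | _, _, _ => []

/-- The weight of a transition in a list of weighted moves. -/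
def moveWeight {S R : Type} [DecidableEq S] [AddCommMonoid R] (l : List (S × Bool × R))
    (s' : S) (d : Bool) : R :=
  (l.map fun x => if x.1 = s' ∧ x.2.1 = d then x.2.2 else 0).sum

lemma moveWeight_nonneg {S : Type} [DecidableEq S] {l : List (S × Bool × ℚ)}
    (h : ∀ x ∈ l, 0 ≤ x.2.2) (s' : S) (d : Bool) : 0 ≤ moveWeight l s' d := by
  refine List.sum_nonneg fun z hz => ?_
  obtain ⟨x, hx, rfl⟩ := List.mem_map.1 hz
  split_ifs
  · exact h x hx
  · exact le_rfl

lemma sum_moveWeight_mul {S : Type} [Fintype S] [DecidableEq S] (l : List (S × Bool × ℝ))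
    (F : S → Bool → ℝ) :
    ∑ s', ∑ d, moveWeight l s' d * F s' d = (l.map fun x => x.2.2 * F x.1 x.2.1).sum := by
  induction l with
  | nil => simp [moveWeight]
  | cons x l ih =>
    obtain ⟨s, b, r⟩ := x
    simp only [moveWeight] at ih
    simp only [moveWeight, List.map_cons, List.sum_cons, add_mul, Finset.sum_add_distrib, ih]
    congr 1
    rw [Finset.sum_eq_single s, Finset.sum_eq_single b] <;> simp +contextual
    intro s' hs
    simp [Ne.symm hs]

/-- The real weights of the moves for a coin with bias `p`. -/
noncomputable def realMoves {A Y : Type} {k : ℕ} (K : Fin k → BlindCounter Y) (bit : Y → Bool)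
    (p : ℝ) (s : CheckState (Fin k) Y) (σ : TapeSymbol A) (y : Y) :
    List (CheckState (Fin k) Y × Bool × ℝ) :=
  (moves K bit s σ y).map fun x => (x.1, x.2.1, p * (x.2.2.1 : ℝ) + (1 - p) * (x.2.2.2 : ℝ))

section
variable {A Y : Type} [DecidableEq Y] [Fintype Y] {k : ℕ} (K : Fin k → BlindCounter Y)
  (bit : Y → Bool) (p : ℝ) (c : ℕ → Y)

lemma endProb_cons_realMoves (t : CheckState (Fin k) Y) (σ : TapeSymbol A)
    (τ : List (TapeSymbol A)) (s : CheckState (Fin k) Y) (j : ℕ) :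
    endProb (fun s σ y => moveWeight (realMoves K bit p s σ y)) c t (σ :: τ) s j =
      ((moves K bit s σ (c j)).map fun x => (p * (x.2.2.1 : ℝ) + (1 - p) * (x.2.2.2 : ℝ)) *
        endProb (fun s σ y => moveWeight (realMoves K bit p s σ y)) c t τ x.1
          (if x.2.1 = true then j + 1 else j)).sum := by
  rw [endProb, sum_moveWeight_mul]
  simp [realMoves, Function.comp_def]

lemma endProb_coin_acc (w : List A) (j : ℕ) :
    endProb (fun s σ y => moveWeight (realMoves K bit p s σ y)) c .acc
      (w.map TapeSymbol.input ++ [TapeSymbol.rightEnd]) .coin j =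
      coinMean p (fun i => if bit (c i) then 1 else 0) w.length j := by
  induction w generalizing j with
  | nil =>
    simp only [List.map_nil, List.nil_append, endProb_cons_realMoves]
    cases h : bit (c j) <;> simp [moves, endProb, coinMean, h]
  | cons a w ih =>
    simp only [List.map_cons, List.cons_append, endProb_cons_realMoves]
    simp [moves, coinMean, ih]

lemma endProb_coin_rej (w : List A) (j : ℕ) :
    endProb (fun s σ y => moveWeight (realMoves K bit p s σ y)) c .rej
      (w.map TapeSymbol.input ++ [TapeSymbol.rightEnd]) .coin j =
      1 - coinMean p (fun i => if bit (c i) then 1 else 0) w.length j := by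
  induction w generalizing j with
  | nil =>
    simp only [List.map_nil, List.nil_append, endProb_cons_realMoves]
    cases h : bit (c j) <;> simp [moves, endProb, coinMean, h]
  | cons a w ih =>
    simp only [List.map_cons, List.cons_append, endProb_cons_realMoves]
    simp [moves, coinMean, ih]
    ring

lemma endProb_counter_acc (w : List A) (i : Fin k) (x : Option Y) (s : Bool) (j : ℕ) :
    endProb (fun s σ y => moveWeight (realMoves K bit p s σ y)) c .acc
      (w.map TapeSymbol.input ++ [TapeSymbol.rightEnd]) (.counter i x s) j = 0 := by
  induction w generalizing x s j with
  | nil =>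
    simp only [List.map_nil, List.nil_append, endProb_cons_realMoves]
    simp [moves, endProb]
  | cons a w ih =>
    simp only [List.map_cons, List.cons_append, endProb_cons_realMoves, moves]
    split_ifs <;> simp [ih]

/-- The exponent `e` is carried by the weights of the two states. At a test each state splits evenly
over both signs: the total `B ^ e + B ^ (-e)` is divided in two equal halves, which is a factor
`penalty B e` and a restart from exponent zero. -/
lemma endProb_counter_rej (w : List A) (i : Fin k) (j : ℕ) (e : ℤ) :
    (penaltyBase : ℝ) ^ e * endProb (fun s σ y => moveWeight (realMoves K bit p s σ y)) c .rej
      (w.map TapeSymbol.input ++ [TapeSymbol.rightEnd]) (.counter i (prevSymbol c j) true) j +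
    (penaltyBase : ℝ) ^ (-e) * endProb (fun s σ y => moveWeight (realMoves K bit p s σ y)) c .rej
      (w.map TapeSymbol.input ++ [TapeSymbol.rightEnd]) (.counter i (prevSymbol c j) false) j =
      2 * (K i).cost penaltyBase c w.length j e := by
  have hB : (penaltyBase : ℝ) ≠ 0 := by norm_num [penaltyBase]
  have hp : ∀ x : ℝ, p * x + (1 - p) * x = x := fun x => by ring
  induction w generalizing j e with
  | nil =>
    simp only [List.map_nil, List.nil_append, endProb_cons_realMoves]
    simp [moves, endProb, BlindCounter.cost, BlindCounter.penalty, hp, zpow_add₀ hB]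
    ring
  | cons a w ih =>
    have ih' := fun e => ih (j + 1) e
    simp only [prevSymbol] at ih'
    simp only [List.map_cons, List.cons_append, endProb_cons_realMoves, moves, List.length_cons,
      BlindCounter.cost]
    by_cases h : (K i).test (prevSymbol c j) (c j) = true
    · have := ih' ((K i).inc (prevSymbol c j) (c j))
      simp only [if_pos h, List.map_cons, List.map_nil, List.sum_cons, List.sum_nil, add_zero, hp, if_true,
        Rat.cast_div, Rat.cast_zpow, Rat.cast_ofNat, BlindCounter.penalty]
      linear_combination ((penaltyBase : ℝ) ^ e + (penaltyBase : ℝ) ^ (-e)) / 2 * this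
    · have := ih' (e + (K i).inc (prevSymbol c j) (c j))
      rw [neg_add, zpow_add₀ hB, zpow_add₀ hB] at this
      simp only [if_neg h, List.map_cons, List.map_nil, List.sum_cons, List.sum_nil, add_zero, hp, if_true,
        Rat.cast_zpow, Bool.false_eq_true, if_false]
      linear_combination this

lemma endProb_start_acc (w : List A) :
    endProb (fun s σ y => moveWeight (realMoves K bit p s σ y)) c .acc (tape w) .start 0 =
      coinMean p (fun i => if bit (c i) then 1 else 0) w.length 0 := by
  rw [tape, endProb_cons_realMoves]
  simp [moves, endProb_coin_acc, endProb_counter_acc, List.map_ofFn,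
    Function.comp_def]

lemma endProb_start_rej (w : List A) :
    endProb (fun s σ y => moveWeight (realMoves K bit p s σ y)) c .rej (tape w) .start 0 =
      1 - coinMean p (fun i => if bit (c i) then 1 else 0) w.length 0 +
        1 / 40 * ∑ i, (K i).cost penaltyBase c w.length 0 0 := by
  have h := fun i => endProb_counter_rej K bit p c w i 0 0
  simp only [prevSymbol, zpow_zero, one_mul, neg_zero] at h
  rw [tape, endProb_cons_realMoves]
  simp only [moves, List.map_cons, List.map_append, List.map_ofFn, List.sum_cons, List.sum_append,
    List.sum_ofFn, Function.comp_def, endProb_coin_rej, Bool.false_eq_true, if_false,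
    ← Finset.sum_add_distrib, Finset.mul_sum]
  congr 1
  · simp
  · refine Finset.sum_congr rfl fun i _ => ?_
    simp only [counterWeight]
    push_cast
    linear_combination 1 / 80 * h i

end

lemma coinMean_mem_Icc {p : ℝ} (hp : p ∈ Set.Icc (0 : ℝ) 1) {F : ℕ → ℝ}
    (hF : ∀ i, F i ∈ Set.Icc (0 : ℝ) 1) (n j : ℕ) : coinMean p F n j ∈ Set.Icc (0 : ℝ) 1 := by
  obtain ⟨h0, h1⟩ := hp
  induction n generalizing j with
  | zero => exact hF j
  | succ n ih =>
    have ha := ih j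
    have hb := ih (j + 1)
    simp only [Set.mem_Icc, coinMean] at *
    constructor <;> nlinarith

lemma moves_nonneg {A Y : Type} {k : ℕ} (K : Fin k → BlindCounter Y) (bit : Y → Bool)
    (s : CheckState (Fin k) Y) (σ : TapeSymbol A) (y : Y) :
    ∀ x ∈ moves K bit s σ y, 0 ≤ x.2.2.1 ∧ 0 ≤ x.2.2.2 := by
  have hB : ∀ z : ℤ, 0 ≤ penaltyBase ^ z := fun z => zpow_nonneg (by norm_num [penaltyBase]) z
  have hw : 0 ≤ counterWeight := by norm_num [counterWeight]
  intro x hx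
  cases s <;> cases σ <;> simp only [moves, List.not_mem_nil] at hx
  · simp only [List.mem_cons, List.mem_append, List.mem_ofFn] at hx
    rcases hx with rfl | ⟨i, rfl⟩ | ⟨i, rfl⟩ <;> simp [hw]
  · simp at hx
    rcases hx with rfl | rfl <;> simp
  · simp at hx
    subst hx
    simp
  · split_ifs at hx <;> simp at hx
    · rcases hx with rfl | rfl <;> simp [div_nonneg (hB _) (zero_le_two (α := ℚ)),
        div_nonneg (inv_nonneg.2 (hB _)) (zero_le_two (α := ℚ))]
    all_goals
      subst hx
      simp only [inv_nonneg]
      exact ⟨hB _, hB _⟩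
  · simp only [List.mem_singleton] at hx
    subst hx
    exact ⟨hB _, hB _⟩

/-- Verification by blind counters that check the certificate, together with a coin whose number
of heads selects a bit of the certificate. -/
theorem exists_verifier_of_blindCounters {A Y : Type} [Finite A] [Fintype Y] [DecidableEq Y]
    {p : ℝ} (hp : p ∈ Set.Icc (0 : ℝ) 1) {k : ℕ} (hk : k ≤ 10) (K : Fin k → BlindCounter Y)
    (bit : Y → Bool) (L : Language A)
    (complete : ∀ w ∈ L, ∃ c : ℕ → Y, (∀ i, (K i).Passes c w.length) ∧
      3 / 4 ≤ coinMean p (fun i => if bit (c i) then 1 else 0) w.length 0)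
    (sound : ∀ w ∉ L, ∀ c : ℕ → Y, (∀ i, (K i).Passes c w.length) →
      coinMean p (fun i => if bit (c i) then 1 else 0) w.length 0 ≤ 1 / 4)
    (hk0 : 0 < k) :
    ∃ V : PostPFAVerifier A Y (Option (CheckState (Fin k) Y)), V.UsesCoin p ∧
      V.Verifies L (2 / 5) := by
  have hB : (1 : ℝ) ≤ penaltyBase := by norm_num [penaltyBase]
  have hc := fun (w : List A) (c : ℕ → Y) (i : Fin k) =>
    (K i).one_le_cost (zero_lt_one.trans_le hB) c w.length 0 0
  have hsum : ∀ (w : List A) (c : ℕ → Y),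
      0 < ∑ i, (K i).cost penaltyBase c w.length 0 0 := fun w c =>
    Finset.sum_pos (fun i _ => zero_lt_one.trans_le (hc w c i)) ⟨⟨0, hk0⟩, Finset.mem_univ _⟩
  have hmean := fun (w : List A) (c : ℕ → Y) => coinMean_mem_Icc hp
    (F := fun i => if bit (c i) then 1 else 0) (fun i => by split_ifs <;> simp)
    w.length 0
  obtain ⟨V, hV, hval⟩ := exists_verifier_of_weights (A := A) (Y := Y)
    (S := CheckState (Fin k) Y) hp
    (h := fun s σ y => moveWeight ((moves K bit s σ y).map fun x => (x.1, x.2.1, x.2.2.1)))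
    (t := fun s σ y => moveWeight ((moves K bit s σ y).map fun x => (x.1, x.2.1, x.2.2.2)))
    (ω := fun s σ y => moveWeight (realMoves K bit p s σ y))
    (start := .start) (acc := .acc) (rej := .rej)
    (fun s σ y => moveWeight_nonneg fun x hx => by
      obtain ⟨z, hz, rfl⟩ := List.mem_map.1 hx
      exact (moves_nonneg K bit s σ y z hz).1)
    (fun s σ y => moveWeight_nonneg fun x hx => by
      obtain ⟨z, hz, rfl⟩ := List.mem_map.1 hx
      exact (moves_nonneg K bit s σ y z hz).2)
    (by
      intro s σ y s' d
      simp only [moveWeight, realMoves, List.map_map]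
      induction moves K bit s σ y with
      | nil => simp
      | cons x l ih =>
        simp only [List.map_cons, List.sum_cons, ih, Function.comp_apply]
        split_ifs <;> push_cast <;> ring)
    (by simp)
    (fun w c => by
      rw [endProb_start_acc, endProb_start_rej]
      linarith [hsum w c])
  refine ⟨V, hV, fun w hw => ?_, fun w hw c => ?_⟩
  · obtain ⟨c, hpass, hc⟩ := complete w hw
    refine ⟨c, ?_⟩
    have hone : ∑ i, (K i).cost penaltyBase c w.length 0 0 = k := by
      have h := fun i =>
        BlindCounter.cost_eq_one_of_passes penaltyBase (hpass i) (zero_add w.length)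
      simp only [BlindCounter.value, Finset.range_zero, Finset.sum_empty] at h
      simp [h]
    have hk' : (k : ℝ) ≤ 10 := by exact_mod_cast hk
    have hk0' : (0 : ℝ) < k := by exact_mod_cast hk0
    -- Total weight is `1 + k / 40 ≤ 5/4` and accepting weight at least `3/4`, with quotient at
    -- least `3/5`.
    rw [(hval w c).1, endProb_start_acc, endProb_start_rej, hone, le_div_iff₀ (by linarith)]
    linarith
  · rw [(hval w c).2, endProb_start_acc, endProb_start_rej,
      le_div_iff₀ (by linarith [hsum w c])]
    by_cases hpass : ∀ i, (K i).Passes c w.length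
    · linarith [sound w hw c hpass, hsum w c]
    · push Not at hpass
      obtain ⟨i, hi⟩ := hpass
      -- A failed counter costs at least `120 / 2`, which is `3/2` after the factor `1/40`.
      -- Accepting weight is at most `1`, so the rejection probability is at least `(3/2) / (5/2) =
      -- 3/5`.
      have h1 := BlindCounter.le_cost_of_not_passes hB hi (zero_add w.length) (by simp)
      have h2 := Finset.single_le_sum
        (f := fun i => (K i).cost (penaltyBase : ℝ) c w.length 0 0)
        (fun i _ => zero_le_one.trans (hc w c i)) (Finset.mem_univ i)
      have h3 : (penaltyBase : ℝ) = 120 := by norm_num [penaltyBase]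
      have h4 := (hmean w c).2
      simp only [BlindCounter.value, Finset.range_zero, Finset.sum_empty] at h1
      linarith [hsum w c]

/-! ### Chebyshev's inequality and the digits of the bias -/

lemma coinMean_mono {p : ℝ} (hp : p ∈ Set.Icc (0 : ℝ) 1) {F G : ℕ → ℝ} (h : ∀ i, F i ≤ G i)
    (n j : ℕ) : coinMean p F n j ≤ coinMean p G n j := by
  induction n generalizing j with
  | zero => exact h j
  | succ n ih =>
    exact add_le_add (mul_le_mul_of_nonneg_left (ih _) hp.1)
      (mul_le_mul_of_nonneg_left (ih _) (sub_nonneg.2 hp.2))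

lemma coinMean_one_sub (p : ℝ) (F : ℕ → ℝ) (n j : ℕ) :
    coinMean p (fun i => 1 - F i) n j = 1 - coinMean p F n j := by
  induction n generalizing j with
  | zero => rfl
  | succ n ih =>
    simp only [coinMean, ih]
    ring

lemma coinMean_const_mul (p b : ℝ) (F : ℕ → ℝ) (n j : ℕ) :
    coinMean p (fun i => b * F i) n j = b * coinMean p F n j := by
  induction n generalizing j with
  | zero => rfl
  | succ n ih =>
    simp only [coinMean, ih]
    ring

/-- Squared bias plus the variance `n * p * (1 - p)` of the binomial distribution. -/
lemma coinMean_sq (p x : ℝ) (n j : ℕ) :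
    coinMean p (fun i => ((i : ℝ) - x) ^ 2) n j = (j + n * p - x) ^ 2 + n * (p * (1 - p)) := by
  induction n generalizing j with
  | zero => simp [coinMean]
  | succ n ih =>
    simp only [coinMean, ih]
    push_cast
    ring

/-- Chebyshev's inequality for the number of heads. -/
lemma coinMean_le_of_eq_zero {p : ℝ} (hp : p ∈ Set.Icc (0 : ℝ) 1) {F : ℕ → ℝ}
    (hF : ∀ i, F i ≤ 1) {n : ℕ} {T : ℝ} (hT : 0 < T)
    (h : ∀ i : ℕ, |(i : ℝ) - n * p| < T → F i = 0) :
    coinMean p F n 0 ≤ n / (4 * T ^ 2) := by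
  have h1 : coinMean p F n 0 ≤
      coinMean p (fun i => (T ^ 2)⁻¹ * ((i : ℝ) - n * p) ^ 2) n 0 := by
    refine coinMean_mono hp (fun i => ?_) n 0
    rcases lt_or_ge |(i : ℝ) - n * p| T with hi | hi
    · rw [h i hi]
      positivity
    · refine (hF i).trans ?_
      rw [← sq_abs ((i : ℝ) - n * p), inv_mul_eq_div, one_le_div (by positivity)]
      gcongr
  rw [coinMean_const_mul, coinMean_sq] at h1
  refine h1.trans ?_
  rw [inv_mul_eq_div, div_le_div_iff₀ (by positivity) (by positivity)]
  have : p * (1 - p) ≤ 1 / 4 := by nlinarith [sq_nonneg (p - 1 / 2)]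
  have hn : (0 : ℝ) ≤ n := n.cast_nonneg
  have h2 : (n : ℝ) * (p * (1 - p)) ≤ n * (1 / 4) := mul_le_mul_of_nonneg_left this hn
  have h3 : 0 < T ^ 2 := by positivity
  push_cast
  nlinarith [mul_le_mul_of_nonneg_right h2 h3.le]

lemma exists_nat_eq_sum_ofDigitsTerm (a : ℕ → Fin 2) (n : ℕ) :
    ∃ N : ℕ, (2 : ℝ) ^ n * ∑ i ∈ Finset.range n, Real.ofDigitsTerm a i = N := by
  induction n with
  | zero => exact ⟨0, by simp⟩
  | succ n ih =>
    obtain ⟨N, hN⟩ := ih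
    refine ⟨2 * N + a n, ?_⟩
    rw [Finset.sum_range_succ, mul_add]
    push_cast
    rw [← hN, Real.ofDigitsTerm]
    push_cast
    field_simp
    ring

lemma coinBias_mem_Icc (I : Set ℕ+) : coinBias I ∈ Set.Icc (0 : ℝ) 1 :=
  ⟨Real.ofDigits_nonneg _, Real.ofDigits_le_one _⟩

/-- Shifting the binary expansion of the bias of the coin such that the digit belonging to `k`
is the last one before the binary point. -/
lemma exists_floor_coinBias (I : Set ℕ+) (k : ℕ+) :
    ∃ N : ℕ, ∃ y ∈ Set.Icc (1 / 4 : ℝ) (1 / 2), coinBias I * 8 ^ (k : ℕ) = 4 * (N + y) ∧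
      (N % 2 = 1 ↔ k ∈ I) := by
  obtain ⟨k, rfl⟩ : ∃ j : ℕ, k = j.succPNat := ⟨k.natPred, by simp⟩
  set a := coinDigit I
  obtain ⟨N, hN⟩ := exists_nat_eq_sum_ofDigitsTerm a (3 * k)
  have h0 := Real.ofDigits_eq_sum_add_ofDigits a (3 * k)
  have h1 := Real.ofDigits_eq_sum_add_ofDigits (fun i => a (i + 3 * k)) 3
  set z := Real.ofDigits fun i => a (i + 3 + 3 * k)
  have hz0 : 0 ≤ z := Real.ofDigits_nonneg _
  have hz1 : z ≤ 1 := Real.ofDigits_le_one _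
  have a1 : a (1 + 3 * k) = 0 := by
    simp [a, coinDigit, Nat.add_mod]
  have a2 : a (2 + 3 * k) = 1 := by
    simp [a, coinDigit, Nat.add_mod]
  have a0 : ((a (3 * k) : ℕ) = 1 ↔ k.succPNat ∈ I) ∧ (a (3 * k) : ℕ) < 2 := by
    refine ⟨?_, (a (3 * k)).2⟩
    have hk : 3 * k / 3 = k := by lia
    simp only [a, coinDigit, Nat.mul_mod_right, if_true]
    split_ifs with h <;> rw [hk] at h <;> simp [h]
  -- With `k` shifted by one, `N` consists of the first `3 * k` digits and the next one is the digit
  -- sought. The digits `0 1` after it and the tail `z` give `(1 + z) / 4`.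
  refine ⟨2 * N + a (3 * k), (1 + z) / 4, ⟨by linarith, by linarith⟩, ?_, ?_⟩
  · have e : coinBias I = Real.ofDigits a := rfl
    have h8 : (2 : ℝ) ^ (3 * k) = 8 ^ k := by
      rw [pow_mul]
      norm_num
    simp only [Finset.sum_range_succ, Finset.sum_range_zero, Real.ofDigitsTerm, zero_add, a1,
      a2] at h1
    rw [h8] at hN
    push_cast at h0 h1 ⊢
    rw [h8] at h0
    rw [e, h0, h1, ← hN, Nat.succPNat_coe, Nat.succ_eq_add_one, pow_succ]
    norm_num
    field_simp
    ring
  · rw [← a0.1]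
    lia

/-- If the bits of the certificate alternate with period `4 * 8 ^ k`, the bit selected by the number
of heads in `64 ^ k` tosses is with probability at least `3 / 4` the digit belonging to `k`. -/
lemma coinMean_alternating (I : Set ℕ+) (k : ℕ+) {b : ℕ → Bool}
    (hb : ∀ i < 64 ^ (k : ℕ), b i = true ↔ i / (4 * 8 ^ (k : ℕ)) % 2 = 1) :
    (k ∈ I → 3 / 4 ≤ coinMean (coinBias I) (fun i => if b i then 1 else 0) (64 ^ (k : ℕ)) 0) ∧
    (k ∉ I → coinMean (coinBias I) (fun i => if b i then 1 else 0) (64 ^ (k : ℕ)) 0 ≤ 1 / 4) := by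
  obtain ⟨N, y, ⟨hy0, hy1⟩, hN, hNI⟩ := exists_floor_coinBias I k
  have hp := coinBias_mem_Icc I
  have h8 : (0 : ℝ) < 8 ^ (k : ℕ) := by positivity
  have h8' : 0 < 8 ^ (k : ℕ) := by positivity
  have h64 : (64 : ℝ) ^ (k : ℕ) = 8 ^ (k : ℕ) * 8 ^ (k : ℕ) := by
    rw [← mul_pow]
    norm_num
  have h64' : 64 ^ (k : ℕ) = 8 ^ (k : ℕ) * 8 ^ (k : ℕ) := by
    rw [← mul_pow]
    norm_num
  -- Block number `N` lies completely below `64 ^ k`, where `hb` applies. Rounding up is possible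
  -- because `4` divides `8 ^ k`.
  have hNlt : 4 * (N + 1) ≤ 8 ^ (k : ℕ) := by
    have h1 : (4 * N : ℝ) < 8 ^ (k : ℕ) := by nlinarith [hp.2]
    have h1' : 4 * N < 8 ^ (k : ℕ) := by exact_mod_cast h1
    have h2 : 4 ∣ 8 ^ (k : ℕ) := (by norm_num : 4 ∣ 8).trans (dvd_pow_self 8 k.ne_zero)
    lia
  -- As `y` is between `1/4` and `1/2`, the mean is at least `8 ^ k` away from both ends of its
  -- block.
  have key : ∀ i : ℕ, |(i : ℝ) - (64 ^ (k : ℕ) : ℕ) * coinBias I| < 8 ^ (k : ℕ) →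
      (b i = true ↔ k ∈ I) := by
    intro i hi
    push_cast at hi
    have e : (64 : ℝ) ^ (k : ℕ) * coinBias I = 8 ^ (k : ℕ) * (4 * (N + y)) := by
      rw [← hN, h64]
      ring
    rw [e, abs_lt] at hi
    have hl : (4 * 8 ^ (k : ℕ) * N : ℝ) < i := by nlinarith
    have hu : (i : ℝ) < 4 * 8 ^ (k : ℕ) * (N + 1) := by nlinarith
    have hl' : 4 * 8 ^ (k : ℕ) * N < i := by exact_mod_cast hl
    have hu' : i < 4 * 8 ^ (k : ℕ) * (N + 1) := by exact_mod_cast hu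
    have hd : i / (4 * 8 ^ (k : ℕ)) = N := by
      refine Nat.div_eq_of_lt_le ?_ ?_ <;> linarith
    rw [hb i, hd, hNI]
    rw [h64']
    nlinarith
  have hq : ((64 ^ (k : ℕ) : ℕ) : ℝ) / (4 * (8 ^ (k : ℕ)) ^ 2) = 1 / 4 := by
    push_cast
    rw [h64]
    field_simp
  constructor <;> intro hk
  · have := coinMean_le_of_eq_zero hp (F := fun i => 1 - if b i then 1 else 0)
      (fun i => by split_ifs <;> norm_num) h8 (n := 64 ^ (k : ℕ))
      (fun i hi => by simp [(key i hi).2 hk])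
    rw [hq, coinMean_one_sub] at this
    linarith
  · have := coinMean_le_of_eq_zero hp (F := fun i => if b i then 1 else 0)
      (fun i => by split_ifs <;> norm_num) h8 (n := 64 ^ (k : ℕ))
      (fun i hi => by simp [mt (key i hi).1 hk])
    rwa [hq] at this

/-! ### Certificate tracks and the counters that test them -/

/-- The letters of a certificate track. A track consists of alternating rising and falling runs. -/
inductive Letter : Type where
  | start | first | up | down | last
  deriving DecidableEq

namespace Letter

instance : Fintype Letter := ⟨{start, first, up, down, last}, fun x => by cases x <;> simp⟩

/-- Falling letters. -/
def isDown : Letter → Bool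
  | down | last => true
  | _ => false

/-- The regular shape `start first* (down⁺ up⁺)* last⁺` of a track: the letter may follow. -/
def follows : Option Letter → Letter → Bool
  | none, start => true
  | some start, first | some start, down | some start, last => true
  | some first, first | some first, down | some first, last => true
  | some down, down | some down, up => true
  | some up, up | some up, down | some up, last => true
  | some last, last => true
  | _, _ => false

/-- The letter at position `j`, in the run number `r` out of `n` runs. -/
def ofRun (n r j : ℕ) : Letter :=
  if j = 0 then start else if r = 0 then first else if r + 1 = n then last
  else if r % 2 = 1 then down else up

end Letter

/-- Counts the violations of the regular shape of a track. -/
@[simps] def shapeCounter : BlindCounter Letter where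
  inc x y := if Letter.follows x y then 0 else 1
  test _ _ := false
  final x := if x = some .last then 0 else 1

/-- Tests that each falling run is `q` times (the first one: `q₀` times) as long as the rising run
before it. -/
@[simps] def fallCounter (q₀ q : ℤ) : BlindCounter Letter where
  inc _ y := match y with
    | .start | .first => q₀
    | .up => q
    | .down | .last => -1
  test x y := x = some .down && y = .up
  final _ := 0

/-- Tests that each rising run other than the first one is `q` times as long as the falling run
before it, and that the weights in the first run add up to zero. -/
@[simps] def riseCounter (q w₀ w₁ : ℤ) : BlindCounter Letter where
  inc _ y := match y with
    | .start => w₀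
    | .first => w₁
    | .up => -1
    | .down => q
    | .last => 0
  test x y := y.isDown && !x.any Letter.isDown
  final _ := 0

/-- Tests that the first run has `32` symbols for each falling run. -/
@[simps] def runCounter : BlindCounter Letter where
  inc x y := match y with
    | .start | .first => -1
    | .up => 0
    | .down | .last => if x.any Letter.isDown then 0 else 32
  test _ _ := false
  final _ := 0

/-- The length of run number `r`, where the first run has length `l`. -/
def runLength (q₀ q l : ℕ) : ℕ → ℕ
  | 0 => l
  | 1 => q₀ * l
  | r + 2 => q * runLength q₀ q l (r + 1)

/-- The position at which run number `r` starts. -/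
def runStart (q₀ q l : ℕ) : ℕ → ℕ
  | 0 => 0
  | r + 1 => runStart q₀ q l r + runLength q₀ q l r

lemma runLength_succ (q₀ q l : ℕ) {r : ℕ} (hr : 1 ≤ r) :
    runLength q₀ q l (r + 1) = q * runLength q₀ q l r := by
  obtain ⟨r, rfl⟩ := Nat.exists_eq_add_of_le' hr
  rfl

/-! ### Tracks that pass the tests have the prescribed run lengths -/

section

variable {t : ℕ → Letter} {m : ℕ}

/-- Violations and the final correction are both nonnegative, so one zero test at the end excludes
all of them. -/
lemma shapeCounter_passes_iff :
    shapeCounter.Passes t m ↔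
      (∀ j < m, Letter.follows (prevSymbol t j) (t j) = true) ∧ prevSymbol t m = some .last := by
  have hv : shapeCounter.value t m =
      ((Finset.range m).filter fun j => ¬ Letter.follows (prevSymbol t j) (t j) = true).card := by
    rw [Finset.card_filter]
    push_cast
    refine Finset.sum_congr rfl fun j _ => ?_
    simp only [shapeCounter]
    split_ifs <;> simp_all
  have hf : shapeCounter.final (prevSymbol t m) = 0 ∨ shapeCounter.final (prevSymbol t m) = 1 := by
    simp only [shapeCounter]
    split_ifs <;> simp
  have h0 : shapeCounter.final (prevSymbol t m) = 0 ↔ prevSymbol t m = some .last := by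
    simp [shapeCounter]
  have h1 : ((Finset.range m).filter fun j =>
      ¬ Letter.follows (prevSymbol t j) (t j) = true).card = 0 ↔
      ∀ j < m, Letter.follows (prevSymbol t j) (t j) = true := by
    simp [Finset.filter_eq_empty_iff]
  rw [← h0, ← h1, BlindCounter.Passes, hv]
  constructor
  · rintro ⟨-, h⟩
    lia
  · rintro ⟨h, h'⟩
    exact ⟨by simp [shapeCounter], by lia⟩

/-- The situation after `i` symbols, of which the last one belongs to run number `r`. -/
structure RunInvariant (q₀ q l : ℕ) (w₀ w₁ : ℤ) (t : ℕ → Letter) (r i : ℕ) : Prop where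
  start_le : runStart q₀ q l r ≤ i
  past : ∀ r' < r, ∀ j, runStart q₀ q l r' ≤ j → j < runStart q₀ q l (r' + 1) →
    ((t j).isDown = true ↔ r' % 2 = 1)
  present : ∀ j, runStart q₀ q l r ≤ j → j < i → ((t j).isDown = true ↔ r % 2 = 1)
  run : runCounter.value t i = 32 * ((r + 1) / 2 : ℕ) - l
  odd : r % 2 = 1 → (fallCounter q₀ q).value t i =
      runLength q₀ q l r - (i - runStart q₀ q l r : ℤ) ∧
    (prevSymbol t i = some .last ∨ prevSymbol t i = some .down ∧
      (riseCounter q w₀ w₁).value t i = q * (i - runStart q₀ q l r : ℤ))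
  even : r % 2 = 0 → prevSymbol t i = some .up ∧
    (fallCounter q₀ q).value t i = q * (i - runStart q₀ q l r : ℤ) ∧
    (riseCounter q w₀ w₁).value t i = runLength q₀ q l r - (i - runStart q₀ q l r : ℤ)

/-- The two counters take turns: while one measures the present run against the run before, the
other accumulates the length prescribed for the next run. A change of direction triggers the test of
the measuring counter, hence can only happen at the prescribed end. -/
lemma RunInvariant.step {q₀ q l : ℕ} {w₀ w₁ : ℤ} {r i : ℕ}
    (h : RunInvariant q₀ q l w₀ w₁ t r i) (hr : 1 ≤ r)
    (hs : Letter.follows (prevSymbol t i) (t i) = true)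
    (hf : (fallCounter q₀ q).test (prevSymbol t i) (t i) = true →
      (fallCounter q₀ q).value t i = 0)
    (hg : (riseCounter q w₀ w₁).test (prevSymbol t i) (t i) = true →
      (riseCounter q w₀ w₁).value t i = 0) :
    RunInvariant q₀ q l w₀ w₁ t r (i + 1) ∨ RunInvariant q₀ q l w₀ w₁ t (r + 1) (i + 1) := by
  obtain ⟨h1, h2, h3, h4, h5, h6⟩ := h
  have hlen := runLength_succ q₀ q l hr
  have hst : runStart q₀ q l (r + 1) = runStart q₀ q l r + runLength q₀ q l r := rfl
  have stay : ((t i).isDown = true ↔ r % 2 = 1) →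
      ∀ j, runStart q₀ q l r ≤ j → j < i + 1 → ((t j).isDown = true ↔ r % 2 = 1) := by
    intro hi j hj hj'
    rcases Nat.lt_succ_iff_lt_or_eq.1 hj' with hj' | rfl
    · exact h3 j hj hj'
    · exact hi
  have switch : i = runStart q₀ q l (r + 1) → ((t i).isDown = true ↔ (r + 1) % 2 = 1) →
      (∀ r' < r + 1, ∀ j, runStart q₀ q l r' ≤ j → j < runStart q₀ q l (r' + 1) →
        ((t j).isDown = true ↔ r' % 2 = 1)) ∧
      ∀ j, runStart q₀ q l (r + 1) ≤ j → j < i + 1 →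
        ((t j).isDown = true ↔ (r + 1) % 2 = 1) := by
    intro hi ht
    refine ⟨fun r' hr' j hj hj' => ?_, fun j hj hj' => ?_⟩
    · rcases Nat.lt_succ_iff_lt_or_eq.1 hr' with hr' | rfl
      · exact h2 r' hr' j hj hj'
      · exact h3 j hj (hi ▸ hj')
    · obtain rfl : j = i := by lia
      exact ht
  rcases Nat.mod_two_eq_zero_or_one r with hr2 | hr2
  · obtain ⟨p1, p2, p3⟩ := h6 hr2
    simp only [p1, riseCounter_test, Option.any_some] at hs hg
    cases ht : t i <;> simp [ht, Letter.follows, Letter.isDown] at hs hg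
    · left
      refine ⟨by lia, h2, stay (by simp [ht, hr2, Letter.isDown]), ?_, by lia, fun _ => ⟨?_, ?_, ?_⟩⟩
      · simp [BlindCounter.value_succ, h4, runCounter_inc, ht]
      · simp [prevSymbol, ht]
      · simp only [BlindCounter.value_succ, p2, fallCounter_inc, ht]
        push_cast
        ring
      · simp only [BlindCounter.value_succ, p3, riseCounter_inc, ht]
        push_cast
        ring
    -- The first falling letter, `down` or `last`: the rise test gives the length of the run just
    -- ended.
    all_goals
      right
      have e : (riseCounter q w₀ w₁).value t i = 0 := hg
      have hi : i = runStart q₀ q l (r + 1) := by lia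
      obtain ⟨c1, c2⟩ := switch hi (by simp [ht, Letter.isDown]; lia)
      refine ⟨by lia, c1, c2, ?_, fun _ => ⟨?_, ?_⟩, by lia⟩
      · simp only [BlindCounter.value_succ, h4, runCounter_inc, ht, p1, Option.any_some,
          Letter.isDown]
        simp only [Bool.false_eq_true, if_false]
        lia
      · simp only [BlindCounter.value_succ, p2, fallCounter_inc, ht, hlen]
        rw [← hi]
        push_cast
        have : (i : ℤ) - runStart q₀ q l r = runLength q₀ q l r := by lia
        rw [this]
        ring
      · first
        | left; simp [prevSymbol, ht]; done
        | refine Or.inr ⟨by simp [prevSymbol, ht], ?_⟩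
          simp only [BlindCounter.value_succ, e, riseCounter_inc, ht]
          rw [← hi]
          push_cast
          ring
  · obtain ⟨p2, p1 | ⟨p1, p3⟩⟩ := h5 hr2
    -- After `last` only `last` can follow, so the rise counter is no longer needed.
    · left
      cases ht : t i <;> simp [p1, ht, Letter.follows] at hs
      refine ⟨by lia, h2, stay (by simp [ht, hr2, Letter.isDown]), ?_, fun _ => ⟨?_, ?_⟩, by lia⟩
      · simp [BlindCounter.value_succ, h4, runCounter_inc, ht, p1, Letter.isDown]
      · simp only [BlindCounter.value_succ, p2, fallCounter_inc, ht]
        push_cast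
        ring
      · simp [prevSymbol, ht]
    · simp only [p1, fallCounter_test] at hf
      cases ht : t i <;> simp [p1, ht, Letter.follows] at hs hf
      · right
        have e : (fallCounter q₀ q).value t i = 0 := hf
        have hi : i = runStart q₀ q l (r + 1) := by lia
        obtain ⟨c1, c2⟩ := switch hi (by simp [ht, Letter.isDown]; lia)
        refine ⟨by lia, c1, c2, ?_, by lia, fun _ => ⟨?_, ?_, ?_⟩⟩
        · simp only [BlindCounter.value_succ, h4, runCounter_inc, ht]
          lia
        · simp [prevSymbol, ht]
        · simp only [BlindCounter.value_succ, e, fallCounter_inc, ht]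
          rw [← hi]
          push_cast
          ring
        · simp only [BlindCounter.value_succ, p3, riseCounter_inc, ht, hlen]
          rw [← hi]
          push_cast
          have : (i : ℤ) - runStart q₀ q l r = runLength q₀ q l r := by lia
          rw [this]
          ring
      · left
        refine ⟨by lia, h2, stay (by simp [ht, hr2, Letter.isDown]), ?_, fun _ => ⟨?_, ?_⟩,
          by lia⟩
        · simp [BlindCounter.value_succ, h4, runCounter_inc, ht, p1, Letter.isDown]
        · simp only [BlindCounter.value_succ, p2, fallCounter_inc, ht]
          push_cast
          ring
        · refine Or.inr ⟨by simp [prevSymbol, ht], ?_⟩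
          simp only [BlindCounter.value_succ, p3, riseCounter_inc, ht]
          push_cast
          ring

/-- The first run, or the situation in a later run. -/
lemma firstRun_or_runInvariant {q₀ q : ℕ} {w₀ w₁ : ℤ}
    (hs : ∀ j < m, Letter.follows (prevSymbol t j) (t j) = true)
    (hf : (fallCounter q₀ q).Passes t m) (hg : (riseCounter q w₀ w₁).Passes t m)
    {i : ℕ} (hi : i < m) :
    ((∀ j < i + 1, (t j).isDown = false) ∧ (t i = .start ∨ t i = .first) ∧
      (fallCounter q₀ q).value t (i + 1) = q₀ * (i + 1) ∧
      (riseCounter q w₀ w₁).value t (i + 1) = w₀ + i * w₁ ∧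
      runCounter.value t (i + 1) = -(i + 1)) ∨
    ∃ l r : ℕ, 1 ≤ l ∧ 1 ≤ r ∧ w₀ + (l - 1) * w₁ = 0 ∧ RunInvariant q₀ q l w₀ w₁ t r (i + 1) := by
  induction i with
  | zero =>
    left
    have h := hs 0 hi
    cases ht : t 0 <;> simp [prevSymbol, ht, Letter.follows] at h
    simp [BlindCounter.value, fallCounter_inc, riseCounter_inc, runCounter_inc, ht, Letter.isDown]
  | succ i ih =>
    rcases ih (by lia) with ⟨h1, h2, h3, h4, h5⟩ | ⟨l, r, hl, hr, hw, h⟩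
    · have hs' := hs (i + 1) hi
      have hg' := hg.1 (i + 1) hi
      have hd : (t i).isDown = false := h1 i (by lia)
      rw [BlindCounter.value_succ _ _ (i + 1), BlindCounter.value_succ _ _ (i + 1),
        BlindCounter.value_succ _ _ (i + 1), h3, h4, h5]
      simp only [prevSymbol] at hs' hg' ⊢
      -- A falling letter here ends the first run with length `l = i + 1`, and the rise test turns
      -- into the equation for `l`.
      have key : (t (i + 1)).isDown = true → RunInvariant q₀ q (i + 1) w₀ w₁ t 1 (i + 1 + 1) ∧
          w₀ + i * w₁ = 0 := by
        intro hu
        have e : (riseCounter q w₀ w₁).value t (i + 1) = 0 := hg' (by simp [hu, hd])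
        refine ⟨⟨by simp [runStart, runLength], ?_, ?_, ?_, fun _ => ⟨?_, ?_⟩, by simp⟩, ?_⟩
        · intro r' hr' j _ hj
          obtain rfl : r' = 0 := by lia
          simp only [runStart, runLength, zero_add] at hj
          simp [h1 j hj]
        · intro j hj hj'
          simp only [runStart, runLength, zero_add] at hj
          obtain rfl : j = i + 1 := by lia
          simp [hu]
        · rw [BlindCounter.value_succ, h5]
          cases ht : t (i + 1) <;> simp [ht, Letter.isDown] at hu <;>
            simp [runCounter_inc, prevSymbol, hd] <;> ring
        · rw [BlindCounter.value_succ, h3]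
          cases ht : t (i + 1) <;> simp [ht, Letter.isDown] at hu <;>
            simp [fallCounter_inc, runStart, runLength] <;> ring
        · rw [BlindCounter.value_succ, e]
          cases ht : t (i + 1) <;> simp [ht, Letter.isDown] at hu <;>
            simp [riseCounter_inc, runStart, runLength, prevSymbol, ht]
        · rw [← h4, e]
      by_cases hu : (t (i + 1)).isDown = true
      · right
        exact ⟨i + 1, 1, by lia, le_rfl, by simpa using (key hu).2, (key hu).1⟩
      · left
        refine ⟨fun j hj => ?_, ?_⟩
        · rcases Nat.lt_succ_iff_lt_or_eq.1 hj with hj | rfl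
          · exact h1 j hj
          · simpa using hu
        · rcases h2 with h2 | h2 <;> cases ht : t (i + 1) <;>
            simp [h2, ht, Letter.follows, Letter.isDown] at hs' hu <;>
            simp [fallCounter_inc, riseCounter_inc, runCounter_inc] <;> ring_nf <;> simp
    · right
      rcases h.step hr (hs _ hi) (hf.1 _ hi) (hg.1 _ hi) with h' | h'
      · exact ⟨l, r, hl, hr, hw, h'⟩
      · exact ⟨l, r + 1, hl, by lia, hw, h'⟩

/-- A track that passes the tests consists of an even number of runs with the right lengths. -/
theorem exists_runs_of_passes {q₀ q : ℕ} {w₀ w₁ : ℤ} (hs : shapeCounter.Passes t m)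
    (hf : (fallCounter q₀ q).Passes t m) (hg : (riseCounter q w₀ w₁).Passes t m) :
    ∃ l R : ℕ, 1 ≤ l ∧ 1 ≤ R ∧ w₀ + (l - 1) * w₁ = 0 ∧ m = runStart q₀ q l (2 * R) ∧
      runCounter.value t m = 32 * R - l ∧
      ∀ r < 2 * R, ∀ j, runStart q₀ q l r ≤ j → j < runStart q₀ q l (r + 1) →
        ((t j).isDown = true ↔ r % 2 = 1) := by
  obtain ⟨hs, hlast⟩ := shapeCounter_passes_iff.1 hs
  obtain _ | m := m
  · simp [prevSymbol] at hlast
  have hlast' : t m = .last := by simpa [prevSymbol] using hlast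
  rcases firstRun_or_runInvariant hs hf hg (Nat.lt_succ_self m) with
    ⟨-, h, -⟩ | ⟨l, r, hl, hr, hw, h1, h2, h3, h4, h5, h6⟩
  · simp [hlast'] at h
  · have hr2 : r % 2 = 1 := by
      by_contra hr2
      have := (h6 (by lia)).1
      simp [hlast] at this
    have e : (fallCounter q₀ q).value t (m + 1) = 0 := by simpa using hf.2
    have hst : runStart q₀ q l (r + 1) = runStart q₀ q l r + runLength q₀ q l r := rfl
    -- No change of direction ends the last run; its length comes from the final test of the fall
    -- counter.
    have hm : m + 1 = runStart q₀ q l (r + 1) := by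
      have := (h5 hr2).1
      lia
    have hR : 2 * ((r + 1) / 2) = r + 1 := by lia
    refine ⟨l, (r + 1) / 2, hl, by lia, hw, by rw [hR, hm], h4, ?_⟩
    rw [hR]
    intro r' hr' j hj hj'
    rcases Nat.lt_succ_iff_lt_or_eq.1 hr' with hr' | rfl
    · exact h2 r' hr' j hj hj'
    · exact h3 j hj (hm ▸ hj')

end

lemma runLength_pos {q₀ q l : ℕ} (hq₀ : 1 ≤ q₀) (hq : 1 ≤ q) (hl : 1 ≤ l) (r : ℕ) :
    1 ≤ runLength q₀ q l r := by
  induction r with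
  | zero => exact hl
  | succ r ih =>
    cases r with
    | zero => exact Nat.mul_pos hq₀ hl
    | succ r => exact Nat.mul_pos hq ih

/-! ### Tracks with the prescribed run lengths pass the tests -/

section

variable {t : ℕ → Letter} {q₀ q l R : ℕ} {w₀ w₁ : ℤ}

/-- The values of the counters after position `i`, which lies in run number `r` out of `n`. -/
structure RunValues (q₀ q l n : ℕ) (w₀ w₁ : ℤ) (t : ℕ → Letter) (r i : ℕ) : Prop where
  lt : r < n
  start_le : runStart q₀ q l r ≤ i
  lt_end : i < runStart q₀ q l (r + 1)
  zero : r = 0 → (fallCounter q₀ q).value t (i + 1) = q₀ * (i + 1) ∧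
    (riseCounter q w₀ w₁).value t (i + 1) = w₀ + i * w₁ ∧ runCounter.value t (i + 1) = -(i + 1)
  odd : r % 2 = 1 →
    (fallCounter q₀ q).value t (i + 1) =
      runLength q₀ q l r - (i + 1 - runStart q₀ q l r : ℤ) ∧
    (r + 1 < n → (riseCounter q w₀ w₁).value t (i + 1) = q * (i + 1 - runStart q₀ q l r : ℤ)) ∧
    (r + 1 = n → (riseCounter q w₀ w₁).value t (i + 1) = 0)
  even : r % 2 = 0 → 1 ≤ r →
    (fallCounter q₀ q).value t (i + 1) = q * (i + 1 - runStart q₀ q l r : ℤ) ∧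
    (riseCounter q w₀ w₁).value t (i + 1) =
      runLength q₀ q l r - (i + 1 - runStart q₀ q l r : ℤ)
  run : 1 ≤ r → runCounter.value t (i + 1) = 32 * ((r + 1) / 2 : ℕ) - l

/-- The symbol at position `i` is admissible. -/
structure Admissible (q₀ q : ℕ) (w₀ w₁ : ℤ) (t : ℕ → Letter) (i : ℕ) : Prop where
  follows : Letter.follows (prevSymbol t i) (t i) = true
  fall : (fallCounter q₀ q).test (prevSymbol t i) (t i) = true →
    (fallCounter q₀ q).value t i = 0
  rise : (riseCounter q w₀ w₁).test (prevSymbol t i) (t i) = true →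
    (riseCounter q w₀ w₁).value t i = 0

lemma one_le_of_runStart_le (hl : 1 ≤ l) {r i : ℕ} (hr : 1 ≤ r) (h : runStart q₀ q l r ≤ i) :
    1 ≤ i := by
  have h1 : runStart q₀ q l 1 ≤ runStart q₀ q l r :=
    monotone_nat_of_le_succ (f := runStart q₀ q l) (fun n => Nat.le_add_right _ _) hr
  simp only [runStart, runLength] at h1
  lia

lemma Letter.ofRun_eq (n : ℕ) {r i : ℕ} (hr : 1 ≤ r) (hi : 1 ≤ i) :
    Letter.ofRun n r i = if r + 1 = n then .last else if r % 2 = 1 then .down else .up := by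
  rw [Letter.ofRun, if_neg (by lia), if_neg (by lia)]

/-- No test applies inside a run, and the counters change linearly there. -/
lemma RunValues.step_stay (hl : 1 ≤ l) {r i : ℕ}
    (ht : ∀ r < 2 * R, ∀ j, runStart q₀ q l r ≤ j → j < runStart q₀ q l (r + 1) →
      t j = Letter.ofRun (2 * R) r j)
    (h : RunValues q₀ q l (2 * R) w₀ w₁ t r i) (hi : i + 1 < runStart q₀ q l (r + 1)) :
    Admissible q₀ q w₀ w₁ t (i + 1) ∧ RunValues q₀ q l (2 * R) w₀ w₁ t r (i + 1) := by
  obtain ⟨h1, h2, h3, h4, h5, h6, h7⟩ := h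
  have e1 := ht r h1 i h2 h3
  have e2 := ht r h1 (i + 1) (by lia) hi
  rcases Nat.eq_zero_or_pos r with rfl | hr
  · simp only [Letter.ofRun, if_true] at e1 e2
    rw [if_neg (by lia)] at e2
    obtain ⟨v1, v2, v3⟩ := h4 rfl
    refine ⟨⟨?_, ?_, ?_⟩, ⟨h1, by lia, hi, fun _ => ⟨?_, ?_, ?_⟩, by lia, by lia, by lia⟩⟩
    · rw [prevSymbol, e1, e2]
      split_ifs <;> rfl
    · simp [e2]
    · simp [e2, Letter.isDown]
    · simp [BlindCounter.value_succ _ _ (i + 1), v1, e2]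
      ring
    · simp [BlindCounter.value_succ _ _ (i + 1), v2, e2]
      ring
    · simp [BlindCounter.value_succ _ _ (i + 1), v3, e2]
      ring
  · have hi1 : 1 ≤ i := one_le_of_runStart_le hl hr h2
    rw [Letter.ofRun_eq _ hr hi1] at e1
    rw [Letter.ofRun_eq _ hr (by lia)] at e2
    have hrun := h7 hr
    rcases Nat.mod_two_eq_zero_or_one r with hr2 | hr2
    · obtain ⟨v1, v2⟩ := h6 hr2 hr
      rw [if_neg (by lia), if_neg (by lia)] at e1 e2
      refine ⟨⟨?_, ?_, ?_⟩, ⟨h1, by lia, hi, by lia, by lia, fun _ _ => ⟨?_, ?_⟩, fun _ => ?_⟩⟩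
      · rw [prevSymbol, e1, e2]
        rfl
      · simp [prevSymbol, e1]
      · simp [e2, Letter.isDown]
      · rw [BlindCounter.value_succ _ _ (i + 1), v1, e2]
        simp
        ring
      · rw [BlindCounter.value_succ _ _ (i + 1), v2, e2]
        simp
        ring
      · rw [BlindCounter.value_succ _ _ (i + 1), hrun, e2]
        simp
    · obtain ⟨v1, v2, v3⟩ := h5 hr2
      rw [if_pos hr2] at e1 e2
      refine ⟨⟨?_, ?_, ?_⟩, ⟨h1, by lia, hi, by lia, fun _ => ⟨?_, fun hlt => ?_, fun heq => ?_⟩, by lia,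
        fun _ => ?_⟩⟩
      · rw [prevSymbol, e1, e2]
        split_ifs <;> rfl
      · rw [e2]
        split_ifs <;> simp
      · rw [prevSymbol, e1]
        split_ifs <;> simp [Letter.isDown]
      · rw [BlindCounter.value_succ _ _ (i + 1), v1, e2]
        split_ifs <;> simp <;> ring
      · rw [BlindCounter.value_succ _ _ (i + 1), v2 hlt, e2, if_neg (by lia)]
        simp
        ring
      · rw [BlindCounter.value_succ _ _ (i + 1), v3 heq, e2, if_pos heq]
        simp
      · rw [BlindCounter.value_succ _ _ (i + 1), hrun, prevSymbol, e1, e2]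
        split_ifs <;> simp [Letter.isDown]

/-- The counter measuring the finished run has reached zero exactly here, for the first run by `hw`.
Any test at the boundary concerns that counter, and the other one holds the length of the next run.
-/
lemma RunValues.step_switch (hl : 1 ≤ l) (hw : w₀ + (l - 1) * w₁ = 0) {r i : ℕ}
    (hpos : ∀ r, 1 ≤ runLength q₀ q l r)
    (ht : ∀ r < 2 * R, ∀ j, runStart q₀ q l r ≤ j → j < runStart q₀ q l (r + 1) →
      t j = Letter.ofRun (2 * R) r j)
    (h : RunValues q₀ q l (2 * R) w₀ w₁ t r i) (hi : i + 1 = runStart q₀ q l (r + 1))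
    (hr' : r + 1 < 2 * R) :
    Admissible q₀ q w₀ w₁ t (i + 1) ∧ RunValues q₀ q l (2 * R) w₀ w₁ t (r + 1) (i + 1) := by
  obtain ⟨h1, h2, h3, h4, h5, h6, h7⟩ := h
  have hst : runStart q₀ q l (r + 1) = runStart q₀ q l r + runLength q₀ q l r := rfl
  have hend : i + 1 < runStart q₀ q l (r + 1 + 1) := by
    have := hpos (r + 1)
    rw [runStart]
    lia
  have hsub : (i : ℤ) + 1 = runStart q₀ q l (r + 1) := by exact_mod_cast hi
  have hlen : (i : ℤ) + 1 - runStart q₀ q l r = runLength q₀ q l r := by lia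
  have e1 := ht r h1 i h2 h3
  have e2 := ht (r + 1) hr' (i + 1) (by lia) hend
  rw [Letter.ofRun_eq _ (by lia) (by lia)] at e2
  rcases Nat.eq_zero_or_pos r with rfl | hr
  · simp only [Letter.ofRun, if_true] at e1
    obtain ⟨v1, v2, v3⟩ := h4 rfl
    have hil : i + 1 = l := by simpa [runStart, runLength] using hi
    have hil' : (i : ℤ) + 1 = l := by exact_mod_cast hil
    have v2' : (riseCounter q w₀ w₁).value t (i + 1) = 0 := by
      rw [v2, ← hw, ← hil']
      ring
    have hprev : (prevSymbol t (i + 1)).any Letter.isDown = false := by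
      rw [prevSymbol, e1]
      split_ifs <;> rfl
    refine ⟨⟨?_, ?_, fun _ => v2'⟩, ⟨hr', by lia, hend, by lia,
      fun _ => ⟨?_, fun hlt => ?_, fun heq => ?_⟩, by lia, fun _ => ?_⟩⟩
    · rw [prevSymbol, e1, e2]
      split_ifs <;> first | rfl | lia
    · rw [prevSymbol, e1]
      split_ifs <;> simp
    · rw [BlindCounter.value_succ _ _ (i + 1), v1, e2]
      simp only [zero_add, runLength, runStart]
      push_cast
      rw [hil']
      split_ifs <;> simp <;> lia
    · rw [BlindCounter.value_succ _ _ (i + 1), v2', e2, if_neg (by lia)]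
      simp [runStart, runLength]
      rw [← hil']
      ring
    · rw [BlindCounter.value_succ _ _ (i + 1), v2', e2, if_pos heq]
      simp
    · rw [BlindCounter.value_succ _ _ (i + 1), v3, e2]
      split_ifs <;> simp [hprev] <;> lia
  · have hi1 : 1 ≤ i := one_le_of_runStart_le hl hr h2
    rw [Letter.ofRun_eq _ hr hi1, if_neg (by lia)] at e1
    have hrun := h7 hr
    have hl' := runLength_succ q₀ q l hr
    rcases Nat.mod_two_eq_zero_or_one r with hr2 | hr2
    · obtain ⟨v1, v2⟩ := h6 hr2 hr
      rw [if_neg (by lia)] at e1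
      rw [if_pos (by lia : (r + 1) % 2 = 1)] at e2
      rw [hlen] at v1 v2
      rw [sub_self] at v2
      refine ⟨⟨?_, ?_, fun _ => v2⟩, ⟨hr', by lia, hend, by lia,
        fun _ => ⟨?_, fun hlt => ?_, fun heq => ?_⟩, by lia, fun _ => ?_⟩⟩
      · rw [prevSymbol, e1, e2]
        split_ifs <;> rfl
      · rw [prevSymbol, e1]
        simp
      · rw [BlindCounter.value_succ _ _ (i + 1), v1, e2, hl']
        push_cast
        rw [hsub]
        split_ifs <;> simp <;> ring
      · rw [BlindCounter.value_succ _ _ (i + 1), v2, e2, if_neg (by lia)]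
        push_cast
        rw [hsub]
        simp
      · rw [BlindCounter.value_succ _ _ (i + 1), v2, e2, if_pos heq]
        simp
      · rw [BlindCounter.value_succ _ _ (i + 1), hrun, prevSymbol, e1, e2]
        split_ifs <;> simp [Letter.isDown] <;> lia
    · obtain ⟨v1, v2, v3⟩ := h5 hr2
      have v2 := v2 hr'
      rw [if_pos hr2] at e1
      rw [if_neg (by lia), if_neg (by lia)] at e2
      rw [hlen] at v1 v2
      rw [sub_self] at v1
      refine ⟨⟨?_, fun _ => v1, ?_⟩, ⟨hr', by lia, hend, by lia, by lia, fun _ _ => ⟨?_, ?_⟩,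
        fun _ => ?_⟩⟩
      · rw [prevSymbol, e1, e2]
        rfl
      · rw [e2]
        simp [Letter.isDown]
      · rw [BlindCounter.value_succ _ _ (i + 1), v1, e2]
        push_cast
        rw [hsub]
        simp
      · rw [BlindCounter.value_succ _ _ (i + 1), v2, e2, hl']
        push_cast
        rw [hsub]
        simp
        ring
      · rw [BlindCounter.value_succ _ _ (i + 1), hrun, e2]
        simp
        lia

/-- A track that consists of an even number of runs with the right lengths passes the tests. -/
theorem passes_of_runs (hq₀ : 1 ≤ q₀) (hq : 1 ≤ q) (hl : 1 ≤ l) (hw : w₀ + (l - 1) * w₁ = 0)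
    (hR : 1 ≤ R)
    (ht : ∀ r < 2 * R, ∀ j, runStart q₀ q l r ≤ j → j < runStart q₀ q l (r + 1) →
      t j = Letter.ofRun (2 * R) r j) :
    shapeCounter.Passes t (runStart q₀ q l (2 * R)) ∧
      (fallCounter q₀ q).Passes t (runStart q₀ q l (2 * R)) ∧
      (riseCounter q w₀ w₁).Passes t (runStart q₀ q l (2 * R)) ∧
      runCounter.value t (runStart q₀ q l (2 * R)) = 32 * R - l := by
  have hpos := runLength_pos hq₀ hq hl
  have hmono : Monotone (runStart q₀ q l) :=
    monotone_nat_of_le_succ fun n => Nat.le_add_right _ _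
  have h0 : ∀ {i}, i < runStart q₀ q l (2 * R) →
      Admissible q₀ q w₀ w₁ t i ∧ ∃ r, RunValues q₀ q l (2 * R) w₀ w₁ t r i := by
    intro i hi
    induction i with
    | zero =>
      have e : t 0 = .start :=
        ht 0 (by lia) 0 le_rfl (by simpa [runStart, runLength] using Nat.pos_of_ne_zero (by lia))
      refine ⟨⟨by simp [prevSymbol, e, Letter.follows], by simp [prevSymbol],
        by simp [e, Letter.isDown]⟩, 0, by lia, le_rfl, by simpa [runStart, runLength] using Nat.pos_of_ne_zero (by lia),
        fun _ => ?_, by lia, by lia, by lia⟩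
      simp [BlindCounter.value, e]
    | succ i ih =>
      obtain ⟨-, r, h⟩ := ih (by lia)
      rcases (Nat.succ_le_of_lt h.lt_end).lt_or_eq with hlt | heq
      · exact ⟨(h.step_stay hl ht hlt).1, r, (h.step_stay hl ht hlt).2⟩
      · have hr : r + 1 < 2 * R := by
          by_contra hr
          have := hmono (show 2 * R ≤ r + 1 by lia)
          lia
        exact ⟨(h.step_switch hl hw hpos ht heq hr).1, r + 1,
          (h.step_switch hl hw hpos ht heq hr).2⟩
  have hm : 1 ≤ runStart q₀ q l (2 * R) :=
    one_le_of_runStart_le hl (by lia : 1 ≤ 2 * R) le_rfl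
  obtain ⟨i, hi⟩ := Nat.exists_eq_add_of_le' hm
  obtain ⟨-, r, h⟩ := h0 (i := i) (by lia)
  -- The last position lies in the last run, because all runs are nonempty.
  have hr : r = 2 * R - 1 := by
    by_contra hne
    have h1 := hmono (show r + 1 ≤ 2 * R - 1 by have := h.lt; lia)
    have h2 := hpos (2 * R - 1)
    have h3 : runStart q₀ q l (2 * R - 1 + 1) =
      runStart q₀ q l (2 * R - 1) + runLength q₀ q l (2 * R - 1) := rfl
    rw [show 2 * R - 1 + 1 = 2 * R by lia] at h3
    have h4 := h.lt_end
    lia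
  have hr1 : r + 1 = 2 * R := by lia
  have hend : i + 1 = runStart q₀ q l r + runLength q₀ q l r := by
    rw [← hi, ← hr1, runStart]
  have e : t i = .last := by
    rw [ht r h.lt i h.start_le h.lt_end, Letter.ofRun_eq _ (by lia)
      (one_le_of_runStart_le hl (by lia) h.start_le), if_pos hr1]
  obtain ⟨v1, -, v2⟩ := h.odd (by lia)
  have v3 := h.run (by lia)
  refine ⟨shapeCounter_passes_iff.2 ⟨fun j hj => (h0 hj).1.follows, ?_⟩,
    ⟨fun j hj => (h0 hj).1.fall, ?_⟩, ⟨fun j hj => (h0 hj).1.rise, ?_⟩, ?_⟩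
  · rw [hi, prevSymbol, e]
  · rw [hi, v1]
    simp
    lia
  · rw [hi, v2 hr1]
    simp
  · rw [hi, v3]
    lia

end

/-! ### The two tracks together -/

lemma runStart_one_one (l r : ℕ) : runStart 1 1 l r = r * l := by
  have h : ∀ r, runLength 1 1 l r = l := by
    intro r
    induction r with
    | zero => rfl
    | succ r ih => cases r <;> simp_all [runLength]
  induction r with
  | zero => simp [runStart]
  | succ r ih => rw [runStart, ih, h, Nat.succ_mul]

/-- A first run of length `8` followed by `7 * 8`, `7 * 64`, … makes each run end at the next power
of `8`; an even number of runs therefore gives a power of `64`. -/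
lemma runStart_seven_eight (r : ℕ) : runStart 7 8 8 (r + 1) = 8 ^ (r + 1) := by
  have h : ∀ r, runLength 7 8 8 (r + 1) = 7 * 8 ^ (r + 1) := by
    intro r
    induction r with
    | zero => rfl
    | succ r ih =>
      rw [runLength, ih]
      ring
  induction r with
  | zero => rfl
  | succ r ih =>
    rw [runStart, ih, h]
    ring

/-- A counter that reads the images of the symbols. -/
def BlindCounter.comap {Y Z : Type} (f : Y → Z) (K : BlindCounter Z) : BlindCounter Y where
  inc x y := K.inc (x.map f) (f y)
  test x y := K.test (x.map f) (f y)
  final x := K.final (x.map f)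

lemma BlindCounter.passes_comap {Y Z : Type} (f : Y → Z) (K : BlindCounter Z) (c : ℕ → Y) (m : ℕ) :
    (K.comap f).Passes c m ↔ K.Passes (fun i => f (c i)) m := by
  have h : ∀ j, (prevSymbol c j).map f = prevSymbol (fun i => f (c i)) j := by
    intro j
    cases j <;> rfl
  simp [BlindCounter.Passes, BlindCounter.value, BlindCounter.comap, h]

/-- The counters for the first track, which consists of runs of the same length, and the second
track, the runs of which start at the powers of `8`. -/
def trackCounters : Fin 7 → BlindCounter (Letter × Letter) :=
  ![shapeCounter.comap Prod.fst, (fallCounter 1 1).comap Prod.fst,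
    (riseCounter 1 0 0).comap Prod.fst, runCounter.comap Prod.fst,
    shapeCounter.comap Prod.snd, (fallCounter 7 8).comap Prod.snd,
    (riseCounter 8 (-7) 1).comap Prod.snd]

lemma trackCounters_pass_iff (c : ℕ → Letter × Letter) (m : ℕ) :
    (∀ i, (trackCounters i).Passes c m) ↔
      (shapeCounter.Passes (fun i => (c i).1) m ∧ (fallCounter 1 1).Passes (fun i => (c i).1) m ∧
        (riseCounter 1 0 0).Passes (fun i => (c i).1) m ∧
        runCounter.value (fun i => (c i).1) m = 0) ∧
      shapeCounter.Passes (fun i => (c i).2) m ∧ (fallCounter 7 8).Passes (fun i => (c i).2) m ∧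
        (riseCounter 8 (-7) 1).Passes (fun i => (c i).2) m := by
  have h : runCounter.Passes (fun i => (c i).1) m ↔ runCounter.value (fun i => (c i).1) m = 0 := by
    simp [BlindCounter.Passes]
  simp [Fin.forall_fin_succ, trackCounters, BlindCounter.passes_comap, h, and_assoc]

/-- If all tests succeed, the word has length `64 ^ k`, and the first track has runs of length
`4 * 8 ^ k`. -/
lemma exists_eq_pow_of_pass {c : ℕ → Letter × Letter} {m : ℕ}
    (h : ∀ i, (trackCounters i).Passes c m) :
    ∃ k : ℕ+, m = 64 ^ (k : ℕ) ∧
      ∀ i < m, (c i).1.isDown = true ↔ i / (4 * 8 ^ (k : ℕ)) % 2 = 1 := by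
  obtain ⟨⟨a1, a2, a3, a4⟩, b1, b2, b3⟩ := (trackCounters_pass_iff c m).1 h
  obtain ⟨n, R, hn, -, -, hm, hv, hd⟩ := exists_runs_of_passes (q₀ := 1) (q := 1) a1 a2 a3
  obtain ⟨l, k, -, hk, hl, hm', -⟩ := exists_runs_of_passes (q₀ := 7) (q := 8) b1 b2 b3
  -- The weights `-7` and `1` make the equation for the first run read `-7 + (l - 1) = 0`.
  obtain rfl : l = 8 := by lia
  have hk2 : 2 * k = 2 * k - 1 + 1 := by lia
  rw [hk2, runStart_seven_eight, ← hk2, pow_mul] at hm'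
  norm_num at hm'
  simp only [runStart_one_one] at hm hd
  rw [a4] at hv
  have hnR : n = 32 * R := by lia
  -- The `2 * R` equal runs give `m = 2 * R * n`. Together with `n = 32 * R` this is `n ^ 2 = 16 * m
  -- = 16 * 64 ^ k`, which is why the run counter uses the factor `32`.
  have hsq : n ^ 2 = (4 * 8 ^ k) ^ 2 := by
    have h64 : (64 : ℕ) ^ k = (8 ^ k) ^ 2 := by
      rw [← pow_mul, mul_comm, pow_mul]
      norm_num
    rw [mul_pow, ← h64, ← hm', hm]
    subst hnR
    ring
  have hn8 : n = 4 * 8 ^ k := Nat.pow_left_injective two_ne_zero hsq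
  refine ⟨⟨k, hk⟩, hm', fun i hi => ?_⟩
  rw [PNat.mk_coe, ← hn8]
  refine hd (i / n) ?_ i (Nat.div_mul_le_self i n) ?_
  · rw [Nat.div_lt_iff_lt_mul (by lia)]
    lia
  · rw [mul_comm]
    exact Nat.lt_mul_div_succ i (by lia)

/-- Every word of length `64 ^ k` has a certificate with which all tests succeed. -/
lemma exists_pass (k : ℕ+) :
    ∃ c : ℕ → Letter × Letter, ∀ i, (trackCounters i).Passes c (64 ^ (k : ℕ)) := by
  obtain ⟨k, rfl⟩ : ∃ j : ℕ, k = j.succPNat := ⟨k.natPred, by simp⟩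
  have h8 : 0 < 8 ^ k := by positivity
  set R := 8 ^ k
  refine ⟨fun i => (Letter.ofRun (2 * R) (i / (32 * R)) i,
    Letter.ofRun (2 * (k + 1)) (Nat.log 8 i) i), (trackCounters_pass_iff _ _).2 ?_⟩
  obtain ⟨a1, a2, a3, a4⟩ := passes_of_runs (q₀ := 1) (q := 1) (l := 32 * R) (R := R)
    (w₀ := 0) (w₁ := 0) (t := fun i => Letter.ofRun (2 * R) (i / (32 * R)) i)
    le_rfl le_rfl (by lia) (by simp) (by lia) (by
      intro r _ j hj hj'
      rw [runStart_one_one] at hj hj'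
      simp only [Nat.div_eq_of_lt_le hj hj'])
  obtain ⟨b1, b2, b3, -⟩ := passes_of_runs (q₀ := 7) (q := 8) (l := 8) (R := k + 1)
    (w₀ := -7) (w₁ := 1) (t := fun i => Letter.ofRun (2 * (k + 1)) (Nat.log 8 i) i)
    (by norm_num) (by norm_num) (by norm_num) (by norm_num) (by lia) (by
      intro r _ j hj hj'
      rw [runStart_seven_eight] at hj'
      -- Position `0` is covered too, since `Nat.log 8 0 = 0`.
      have hlog : Nat.log 8 j = r := by
        cases r with
        | zero => exact Nat.log_of_lt (by simpa using hj')
        | succ r =>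
          rw [runStart_seven_eight] at hj
          exact Nat.log_eq_of_pow_le_of_lt_pow hj hj'
      simp only [hlog])
  have hm : runStart 1 1 (32 * R) (2 * R) = 64 ^ (k + 1) := by
    rw [runStart_one_one, pow_succ, show (64 : ℕ) = 8 * 8 by norm_num, mul_pow]
    ring
  have hm' : runStart 7 8 8 (2 * (k + 1)) = 64 ^ (k + 1) := by
    rw [show 2 * (k + 1) = 2 * k + 1 + 1 by ring, runStart_seven_eight,
      show 2 * k + 1 + 1 = 2 * (k + 1) by ring, pow_mul]
    norm_num
  rw [hm] at a1 a2 a3 a4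
  rw [hm'] at b1 b2 b3
  exact ⟨⟨a1, a2, a3, by rw [Nat.succPNat_coe, Nat.succ_eq_add_one, a4]; push_cast; ring⟩,
    b1, b2, b3⟩

/-! ### The languages `UPOWER6 I` and uncountability -/

lemma mem_UPOWER6_iff (I : Set ℕ+) (w : List (Fin 1)) :
    w ∈ UPOWER6 I ↔ ∃ k ∈ I, w.length = 64 ^ (k : ℕ) := by
  have h : ∀ k : ℕ+, w = List.replicate (2 ^ (6 * (k : ℕ))) 0 ↔ w.length = 64 ^ (k : ℕ) := by
    intro k
    rw [List.eq_replicate_iff, pow_mul]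
    norm_num
  change (∃ k ∈ I, _) ↔ _
  simp only [h]

lemma UPOWER6_injective : Function.Injective UPOWER6 := by
  intro I J hIJ
  ext k
  have h : ∀ K : Set ℕ+, List.replicate (64 ^ (k : ℕ)) (0 : Fin 1) ∈ UPOWER6 K ↔ k ∈ K := by
    intro K
    rw [mem_UPOWER6_iff, List.length_replicate]
    refine ⟨?_, fun hk => ⟨k, hk, rfl⟩⟩
    rintro ⟨j, hj, e⟩
    have := Nat.pow_right_injective (by norm_num : 2 ≤ 64) e
    rwa [PNat.coe_injective this]
  rw [← h I, ← h J, hIJ]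

theorem exists_verifier_UPOWER6 (I : Set ℕ+) :
    ∃ (Y S : Type) (_ : Fintype Y) (_ : Nonempty Y) (_ : Fintype S) (_ : DecidableEq S)
      (V : PostPFAVerifier (Fin 1) Y S),
      V.UsesCoin (coinBias I) ∧ V.Verifies (UPOWER6 I) (2 / 5) := by
  obtain ⟨V, hV⟩ := exists_verifier_of_blindCounters (A := Fin 1) (coinBias_mem_Icc I)
    (by norm_num) trackCounters (fun y => y.1.isDown) (UPOWER6 I)
    (fun w hw => by
      obtain ⟨k, hk, hw⟩ := (mem_UPOWER6_iff I w).1 hw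
      obtain ⟨c, hc⟩ := exists_pass k
      -- The bits of the certificate need not be computed: they are determined by the fact that it
      -- passes the tests.
      obtain ⟨k', hk', hb⟩ := exists_eq_pow_of_pass hc
      obtain rfl : k = k' :=
        PNat.coe_injective (Nat.pow_right_injective (by norm_num : 2 ≤ 64) hk')
      rw [hw]
      exact ⟨c, hc, (coinMean_alternating I k hb).1 hk⟩)
    (fun w hw c hc => by
      obtain ⟨k, hk, hb⟩ := exists_eq_pow_of_pass hc
      have hkI : k ∉ I := fun h => hw ((mem_UPOWER6_iff I w).2 ⟨k, h, hk⟩)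
      rw [hk] at hb ⊢
      exact (coinMean_alternating I k hb).2 hkI)
    (by norm_num)
  exact ⟨_, _, inferInstance, ⟨(.start, .start)⟩, inferInstance, inferInstance, V, hV⟩

theorem mainTheorem1 :
    (∀ I : Set ℕ+,
      ∃ (Y S : Type) (_ : Fintype Y) (_ : Nonempty Y) (_ : Fintype S) (_ : DecidableEq S)
        (V : PostPFAVerifier (Fin 1) Y S),
        V.UsesCoin (coinBias I) ∧ V.Verifies (UPOWER6 I) (2 / 5)) ∧
    ¬ {L : Language (Fin 1) | IsVerifiedByPostPFA L}.Countable := by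
  refine ⟨exists_verifier_UPOWER6, fun h => ?_⟩
  have hr : (Set.range UPOWER6).Countable := by
    refine h.mono ?_
    rintro _ ⟨I, rfl⟩
    obtain ⟨Y, S, i₁, i₂, i₃, i₄, V, -, hV⟩ := exists_verifier_UPOWER6 I
    exact ⟨Y, S, i₁, i₂, i₃, i₄, V, 2 / 5, by norm_num, hV⟩
  have hc : Countable (Set ℕ+) := by
    have := hr.to_subtype
    exact (Equiv.ofInjective _ UPOWER6_injective).injective.countable
  -- Countability would inject the power set of `ℕ+` into `ℕ+`, against Cantor's theorem.
  obtain ⟨f, hf⟩ := exists_injective_nat (Set ℕ+)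
  exact Function.cantor_injective (fun I => (f I).succPNat)
    (fun I J hIJ => hf (Nat.succPNat_injective hIJ))
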